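/- Let $(R,\mathfrak m,k)$ be a Noetherian local ring of dimension $d\ge 1$ with infinite residue field $k$, and assume that $R$ is Cohen--Macaulay and equicharacteristic (i.e. $\operatorname{char} R=\operatorname{char} k$). Let $I$ be an $\mathfrak m$-primary ideal, and assume that $I^2\cap H=HI$ for some minimal reduction $H$ of $I$. Then $I$ is stretched if and only if $I$ is $j$-stretched. Here $\lambda$ denotes length. An ideal $J\subseteq I$ is a reduction of $I$ if $I^{r+1}=JI^r$ for some $r\ge 0$, and a minimal reduction is a reduction that is minimal with respect to inclusion. The ideal $I$ is \emph{stretched} if there is a minimal reduction $J$ of $I$ (not necessarily the given $H$) such that $J\cap I^2=JI$ and $HF_{I/J}(2)\le 1$, where $HF_{I/J}(n)=\lambda\big((I/J)^n/(I/J)^{n+1}\big)$ is the Hilbert function of the ideal $I/J$ of $R/J$. The ideal $I$ is \emph{$j$-stretched} if, for general elements $x_1,\dots,x_d$ of $I$, one has $$\lambda\big(\overline I^{\,2}/(x_d\overline I+\overline I^{\,3})\big)\le 1,$$ where bars denote images in $\overline R=R/\big((x_1,\dots,x_{d-1}):I^\infty\big)$ and $(x_1,\dots,x_{d-1}):I^\infty=\{b\in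 R : bI^\delta\subseteq (x_1,\dots,x_{d-1})\text{ for some }\delta>0\}$. A property holds for general elements $x_1,\dots,x_d$ of $I=(a_1,\dots,a_s)$ if there is a Zariski dense open subset $U\subseteq k^{ds}$ such that it holds for $x_i=\sum_{j=1}^s\lambda_{ij}a_j$ $(1\le i\le d)$ whenever $(\lambda_{ij})\in R^{ds}$ has residue $(\overline{\lambda_{ij}})\in U$. -/

import Mathlib

open IsLocalRing

noncomputable section

/-- A Noetherian local ring `R` is Cohen-Macaulay if its depth equals its dimension, i.e. if there
is an `R`-regular sequence in the maximal ideal whose length is `dim R`. -/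
def IsCohenMacaulayLocal (R : Type*) [CommRing R] [IsLocalRing R] : Prop :=
  ∃ rs : List R, (∀ r ∈ rs, r ∈ maximalIdeal R) ∧ RingTheory.Sequence.IsRegular R rs ∧
    ringKrullDim R = (rs.length : ℕ)

/-- A local ring is equicharacteristic if it has the same characteristic as its residue field. -/
def IsEquicharacteristic (R : Type*) [CommRing R] [IsLocalRing R] : Prop :=
  ringChar R = ringChar (ResidueField R)

/-- `J` is a reduction of `I`: `J ⊆ I` and `I ^ (r + 1) = J I ^ r` for some `r`. -/
def IsReduction {R : Type*} [CommRing R] (J I : Ideal R) : Prop :=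
  J ≤ I ∧ ∃ r : ℕ, I ^ (r + 1) = J * I ^ r

/-- `J` is a reduction of `I`, minimal with respect to inclusion. -/
def IsMinimalReduction {R : Type*} [CommRing R] (J I : Ideal R) : Prop :=
  Minimal (fun L => IsReduction L I) J

/-- The length `λ(A / B)` of the `S`-module `A / B`, for ideals `B ⊆ A` of `S`. -/
def lengthQuot {S : Type*} [CommRing S] (A B : Ideal S) : ℕ∞ :=
  Module.length S (A ⧸ Submodule.comap A.subtype B)

/-- The Hilbert function of an ideal: `HF_A(n) = λ(A ^ n / A ^ (n + 1))`. -/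
def hilbertFun {S : Type*} [CommRing S] (A : Ideal S) (n : ℕ) : ℕ∞ :=
  lengthQuot (A ^ n) (A ^ (n + 1))

/-- `I` is stretched: it has a minimal reduction `H` such that `H ∩ I ^ 2 = H I` and the Hilbert
function of the ideal `I / H` of `R / H` satisfies `HF_{I/H}(2) ≤ 1`. -/
def IsStretched {R : Type*} [CommRing R] (I : Ideal R) : Prop :=
  ∃ H : Ideal R, IsMinimalReduction H I ∧ H ⊓ I ^ 2 = H * I ∧
    hilbertFun (I.map (Ideal.Quotient.mk H)) 2 ≤ 1

/-- Zariski open subsets of affine space `k ^ σ`. -/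
def IsZariskiOpen {σ k : Type*} [Field k] (U : Set (σ → k)) : Prop :=
  ∃ T : Set (MvPolynomial σ k), U = {x | ∃ f ∈ T, MvPolynomial.eval x f ≠ 0}

/-- Zariski dense open subsets of affine space `k ^ σ`. -/
def IsZariskiDenseOpen {σ k : Type*} [Field k] (U : Set (σ → k)) : Prop :=
  IsZariskiOpen U ∧ ∀ V : Set (σ → k), IsZariskiOpen V → V.Nonempty → (U ∩ V).Nonempty

/-- `P x₁ … x_t` holds for general elements `x₁, …, x_t` of `I`: whenever `I = (a₁, …, a_s)`, there
is a Zariski dense open subset `U` of `k ^ (t s)` such that `P` holds for the elements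
`x_i = ∑ j, c i j * a j` as soon as the matrix of residues of the `c i j` lies in `U`. -/
def ForGeneral {R : Type*} [CommRing R] [IsLocalRing R] (I : Ideal R) (t : ℕ)
    (P : (Fin t → R) → Prop) : Prop :=
  ∀ (s : ℕ) (a : Fin s → R), Ideal.span (Set.range a) = I →
    ∃ U : Set (Fin t × Fin s → ResidueField R), IsZariskiDenseOpen U ∧
      ∀ c : Fin t × Fin s → R, (fun p => residue R (c p)) ∈ U →
        P (fun i => ∑ j, c (i, j) * a j)

/-- The saturation `J : I ^ ∞ = {b | ∃ δ > 0, b I ^ δ ⊆ J}`. -/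
def idealSaturation {R : Type*} [CommRing R] (J I : Ideal R) : Ideal R where
  carrier := {b | ∃ δ : ℕ, 0 < δ ∧ ∀ y ∈ I ^ δ, b * y ∈ J}
  zero_mem' := ⟨1, one_pos, fun y _ => by simp⟩
  add_mem' := by
    rintro b c ⟨m, hm, hb⟩ ⟨n, hn, hc⟩
    refine ⟨m + n, by omega, fun y hy => ?_⟩
    rw [add_mul]
    exact J.add_mem (hb y (Ideal.pow_le_pow_right (by omega) hy))
      (hc y (Ideal.pow_le_pow_right (by omega) hy))
  smul_mem' := by
    rintro r b ⟨m, hm, hb⟩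
    refine ⟨m, hm, fun y hy => ?_⟩
    rw [smul_eq_mul, mul_assoc]
    exact J.mul_mem_left r (hb y hy)

/-- For an ideal `Q = J_{d-1} : I ^ ∞` and an element `x = x_d` of `I`, the length
`λ(Ī ^ 2 / (x Ī + Ī ^ 3))`, where bars denote images in `R̄ = R / Q`. -/
def jStretchedLength {R : Type*} [CommRing R] (I Q : Ideal R) (x : R) : ℕ∞ :=
  lengthQuot ((I.map (Ideal.Quotient.mk Q)) ^ 2)
    (Ideal.span {Ideal.Quotient.mk Q x} * I.map (Ideal.Quotient.mk Q) +
      (I.map (Ideal.Quotient.mk Q)) ^ 3)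

/-- `I` is `j`-stretched, where `d = n + 1 = dim R`: for general elements `x₁, …, x_d` of `I`, and
with `R̄ = R / ((x₁, …, x_{d-1}) : I ^ ∞)`, one has `λ(Ī ^ 2 / (x_d Ī + Ī ^ 3)) ≤ 1`.
The notion is meant for ideals of maximal analytic spread `d`, such as the ideals primary to the
maximal ideal. -/
def IsJStretched {R : Type*} [CommRing R] [IsLocalRing R] (I : Ideal R) : Prop :=
  ∃ n : ℕ, ringKrullDim R = (n + 1 : ℕ) ∧
    ForGeneral I (n + 1) fun x =>
      jStretchedLength I
        (idealSaturation (Ideal.span (Set.range fun i : Fin n => x i.castSucc)) I)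
        (x (Fin.last n)) ≤ 1

end

/-! Let `J = (x₁, …, x_d)` with the `xᵢ` in `I`, and let `Q = (x₁, …, x_{d-1}) : I^∞`. Both notions
are compared with `I² / (J I + I³)`. If `J ∩ I² = J I`, the stretched condition on `J` says that
this module has length at most one. The module in the `j`-stretched condition is always a quotient
of it, because `J I ⊆ x_d I + Q`. So stretched implies `j`-stretched as soon as the bound on `I² /
(J I + I³)` passes from one choice of `x` to general ones.

Conversely, take `x` so general that the `j`-stretched bound holds, `J` is a reduction of `I`, and
`J ∩ I² = J I`. Then `J` is a minimal reduction and `x` is a system of parameters, hence a regular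
sequence. Therefore `Q ⊆ J`, and the bound descends to `I² / (J ∩ I² + I³)`.

Three openness statements carry the proof, each spreading a property from one special point (a known
minimal reduction) by means of determinants that do not vanish modulo the maximal ideal `𝔪`.
`mul_le_of_general` treats the reduction property. `quotLengthLEOne_of_general` treats length at
most one; besides bounding the number of generators, one must keep `𝔪` annihilating the quotient,
which is the point of `specialSpan_sup_eq_top_of_general`. `coefficients_mem_of_general` treats `J ∩
I² = J I`: for a regular sequence this means that the `xᵢ` are independent over `R / I` in `I / I²`,
and independence can be tested on the socle of `R / I`, where it is injectivity of a matrix over the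
residue field.

Two classical facts complete the argument: minimal reductions of `I` are generated by `d` elements
(`IsMinimalReduction.exists_span_range_eq`, with converse `isMinimalReduction_of_card_le`), and
parameters in a Cohen-Macaulay local ring are regular (`IsCohenMacaulayLocal.mem_span_of_mul_mem`).
-/

/-! ### Open conditions on cokernels of polynomial matrices over a local ring -/

theorem residue_eval {R σ : Type*} [CommRing R] [IsLocalRing R] (c : σ → R)
    (F : MvPolynomial σ R) :
    residue R (MvPolynomial.eval c F) =
      MvPolynomial.eval (fun p => residue R (c p)) (MvPolynomial.map (residue R) F) :=
  MvPolynomial.map_eval (residue R) c F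

theorem isUnit_eval_iff {R σ : Type*} [CommRing R] [IsLocalRing R] (c : σ → R)
    (F : MvPolynomial σ R) :
    IsUnit (MvPolynomial.eval c F) ↔
      MvPolynomial.eval (fun p => residue R (c p)) (MvPolynomial.map (residue R) F) ≠ 0 := by
  rw [← residue_eval, residue_ne_zero_iff_isUnit]

/-- A matrix with unit determinant expresses every vector as a combination of its rows. -/
theorem exists_eq_sum_rows {R ι : Type*} [CommRing R] [Fintype ι] [DecidableEq ι]
    (M : Matrix ι ι R) (hM : IsUnit M.det) (x : ι → R) : ∃ r : ι → R, x = ∑ i, r i • M i := by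
  refine ⟨Matrix.vecMul x M⁻¹, ?_⟩
  have h : Matrix.vecMul (Matrix.vecMul x M⁻¹) M = x := by
    rw [Matrix.vecMul_vecMul, Matrix.nonsing_inv_mul M hM, Matrix.vecMul_one]
  conv_lhs => rw [← h]
  exact Matrix.vecMul_eq_sum _ _

/-- A spanning family of `k ^ ι` contains a basis. -/
theorem exists_det_ne_zero_of_span_eq_top {k ι α : Type*} [Field k] [Fintype ι] [DecidableEq ι]
    (v : α → ι → k) (hv : Submodule.span k (Set.range v) = ⊤) :
    ∃ b : ι → α, (Matrix.of fun i => v (b i)).det ≠ 0 := by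
  obtain ⟨κ, a, -, hspan, hli⟩ := exists_linearIndependent' k v
  let B : Module.Basis κ k (ι → k) := Module.Basis.mk hli (by rw [hspan, hv])
  let e : ι ≃ κ := (Pi.basisFun k ι).indexEquiv B
  refine ⟨a ∘ e, ?_⟩
  have h : LinearIndependent k (Matrix.of fun i => v ((a ∘ e) i)).row :=
    hli.comp e e.injective
  rw [Matrix.linearIndependent_rows_iff_isUnit, Matrix.isUnit_iff_isUnit_det] at h
  exact h.ne_zero

/-- A spanning family of `R ^ ι`, with `R` local, contains a basis. -/
theorem exists_isUnit_det_of_span_eq_top {R ι α : Type*} [CommRing R] [IsLocalRing R] [Fintype ι]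
    [DecidableEq ι] (v : α → ι → R) (hv : Submodule.span R (Set.range v) = ⊤) :
    ∃ b : ι → α, IsUnit (Matrix.of fun i => v (b i)).det := by
  obtain ⟨b, hb⟩ := exists_det_ne_zero_of_span_eq_top
    (fun a i => residue R (v a i)) (by
      rw [eq_top_iff]
      rintro y -
      choose x hx using fun i => residue_surjective (R := R) (y i)
      have hmem : x ∈ Submodule.span R (Set.range v) := hv ▸ Submodule.mem_top
      have key : ∀ z ∈ Submodule.span R (Set.range v), (fun i => residue R (z i)) ∈
          Submodule.span (ResidueField R) (Set.range fun a i => residue R (v a i)) := by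
        intro z hz
        induction hz using Submodule.span_induction with
        | mem z hz =>
          obtain ⟨a, rfl⟩ := hz
          exact Submodule.subset_span ⟨a, rfl⟩
        | zero =>
          convert Submodule.zero_mem _ using 1
          ext i; simp
        | add y z _ _ hy hz =>
          convert Submodule.add_mem _ hy hz using 1
          ext i; simp
        | smul r z _ hz =>
          convert Submodule.smul_mem _ (residue R r) hz using 1
          ext i; simp
      convert key x hmem using 1
      ext i; simp [hx])
  refine ⟨b, ?_⟩
  rw [← residue_ne_zero_iff_isUnit, RingHom.map_det]
  exact hb

/-- The span of a family of vectors with polynomial entries, specialized at a point. -/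
def specialSpan {R σ ι α : Type*} [CommRing R] (g : α → ι → MvPolynomial σ R) (c : σ → R) :
    Submodule R (ι → R) :=
  Submodule.span R (Set.range fun a i => MvPolynomial.eval c (g a i))

theorem eval_mem_specialSpan {R σ ι α : Type*} [CommRing R] (g : α → ι → MvPolynomial σ R)
    (c : σ → R) (a : α) : (fun i => MvPolynomial.eval c (g a i)) ∈ specialSpan g c :=
  Submodule.subset_span ⟨a, rfl⟩

theorem eq_top_of_rows_mem {R ι : Type*} [CommRing R] [Fintype ι] [DecidableEq ι]
    (L : Submodule R (ι → R)) (M : Matrix ι ι R) (hM : IsUnit M.det) (h : ∀ i, M i ∈ L) :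
    L = ⊤ := by
  rw [eq_top_iff]
  rintro x -
  obtain ⟨r, rfl⟩ := exists_eq_sum_rows M hM x
  exact Submodule.sum_mem _ fun i _ => L.smul_mem _ (h i)

theorem det_eval {R σ ι : Type*} [CommRing R] [Fintype ι] [DecidableEq ι]
    (M : Matrix ι ι (MvPolynomial σ R)) (c : σ → R) :
    MvPolynomial.eval c M.det = (M.map (MvPolynomial.eval c)).det :=
  RingHom.map_det _ _

/-- If a family of polynomial vectors spans at one point, then it does at general points. -/
theorem specialSpan_eq_top_of_general {R σ ι α : Type*} [CommRing R] [IsLocalRing R] [Finite ι]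
    (g : α → ι → MvPolynomial σ R) (c₀ : σ → R) (h : specialSpan g c₀ = ⊤) :
    ∃ f : MvPolynomial σ (ResidueField R), f ≠ 0 ∧
      ∀ c : σ → R, MvPolynomial.eval (fun p => residue R (c p)) f ≠ 0 → specialSpan g c = ⊤ := by
  classical
  cases nonempty_fintype ι
  obtain ⟨b, hb⟩ := exists_isUnit_det_of_span_eq_top _ h
  let M : Matrix ι ι (MvPolynomial σ R) := Matrix.of fun i => g (b i)
  have hM : ∀ c, MvPolynomial.eval c M.det =
      (Matrix.of fun i j => MvPolynomial.eval c (g (b i) j)).det := det_eval M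
  refine ⟨MvPolynomial.map (residue R) M.det, ?_, fun c hc => ?_⟩
  · intro h0
    have := (isUnit_eval_iff c₀ M.det).1 (by rw [hM]; exact hb)
    simp [h0] at this
  · rw [← isUnit_eval_iff, hM] at hc
    exact eq_top_of_rows_mem _ _ hc fun i => eval_mem_specialSpan g c (b i)

/-- If `u` is a row vector and the other rows of `M` and `u` lie in `L`, then so does the multiple
of the row `M i₀` by the determinant obtained by replacing this row by `u`. -/
theorem det_updateRow_smul_mem {R ι : Type*} [CommRing R] [Fintype ι] [DecidableEq ι]
    (L : Submodule R (ι → R)) (M : Matrix ι ι R) (hM : IsUnit M.det) (i₀ : ι)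
    (h : ∀ i, i ≠ i₀ → M i ∈ L) (u : ι → R) (hu : u ∈ L) :
    (M.updateRow i₀ u).det • M i₀ ∈ L := by
  obtain ⟨r, rfl⟩ := exists_eq_sum_rows M hM u
  rw [Matrix.det_updateRow_sum]
  have h1 : r i₀ • M i₀ ∈ L := by
    rw [← Finset.add_sum_erase _ _ (Finset.mem_univ i₀)] at hu
    refine (Submodule.add_mem_iff_left _ ?_).1 hu
    exact Submodule.sum_mem _ fun i hi => L.smul_mem _ (h i (Finset.ne_of_mem_erase hi))
  rw [smul_eq_mul, mul_comm, mul_smul]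
  exact L.smul_mem _ h1

open TensorProduct in
/-- A finite module over a local ring has a finite family of generators all of whose relations have
coefficients in the maximal ideal. -/
theorem exists_minimal_generators (R N : Type*) [CommRing R] [IsLocalRing R] [AddCommGroup N]
    [Module R N] [Module.Finite R N] : ∃ (p : ℕ) (v : Fin p → N),
      Submodule.span R (Set.range v) = ⊤ ∧
        ∀ y : Fin p → R, ∑ l, y l • v l = 0 → ∀ l, y l ∈ maximalIdeal R := by
  let B := Module.finBasis (ResidueField R) (ResidueField R ⊗[R] N)
  choose v hv using fun l => TensorProduct.mk_surjective R N (ResidueField R)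
    residue_surjective (B l)
  refine ⟨_, v, span_eq_top_of_tmul_eq_basis v B hv, fun y hy l => ?_⟩
  have h1 : ∑ l, residue R (y l) • B l = 0 := by
    have h2 := congrArg (TensorProduct.mk R (ResidueField R) N 1) hy
    simp only [map_sum, map_smul, map_zero, hv] at h2
    exact h2
  exact (residue_eq_zero_iff _).1 (Fintype.linearIndependent_iff.1 B.linearIndependent _ h1 l)

/-- The maximal ideal of a Noetherian local ring has a finite family of generators all of whose
relations have coefficients in the maximal ideal. -/
theorem exists_minimal_generators_maximalIdeal (R : Type*) [CommRing R] [IsLocalRing R]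
    [IsNoetherianRing R] : ∃ (r : ℕ) (t : Fin r → R),
      Ideal.span (Set.range t) = maximalIdeal R ∧
        ∀ y : Fin r → R, ∑ l, y l * t l = 0 → ∀ l, y l ∈ maximalIdeal R := by
  obtain ⟨r, t, ht, hmin⟩ := exists_minimal_generators R (maximalIdeal R)
  refine ⟨r, fun l => (t l : R), ?_, fun y hy => hmin y (Subtype.ext (by simpa using hy))⟩
  have h' := congrArg (Submodule.map (maximalIdeal R).subtype) ht
  rw [Submodule.map_span, ← Set.range_comp, Submodule.map_top, Submodule.range_subtype] at h'
  exact h'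

/-- If the cokernel of a family of polynomial vectors has length at most one at one point, then it
does so at general points. -/
theorem specialSpan_sup_eq_top_of_general {R σ ι α : Type*} [CommRing R] [IsLocalRing R]
    [IsNoetherianRing R] [Finite ι]
    (g : α → ι → MvPolynomial σ R) (c₀ : σ → R) (w : ι → R)
    (h₁ : specialSpan g c₀ ⊔ Submodule.span R {w} = ⊤)
    (h₂ : ∀ t ∈ maximalIdeal R, t • w ∈ specialSpan g c₀) :
    ∃ f : MvPolynomial σ (ResidueField R), f ≠ 0 ∧
      ∀ c : σ → R, MvPolynomial.eval (fun p => residue R (c p)) f ≠ 0 →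
        ∃ w : ι → R, specialSpan g c ⊔ Submodule.span R {w} = ⊤ ∧
          ∀ t ∈ maximalIdeal R, t • w ∈ specialSpan g c := by
  classical
  cases nonempty_fintype ι
  -- The index `none` stands for the extra vector `w`.
  let v : Option α → ι → R := fun o => o.elim w fun a i => MvPolynomial.eval c₀ (g a i)
  have hv : Submodule.span R (Set.range v) = ⊤ := by
    rw [eq_top_iff, ← h₁, sup_le_iff]
    constructor
    · exact Submodule.span_mono (by rintro _ ⟨a, rfl⟩; exact ⟨some a, rfl⟩)
    · exact Submodule.span_mono (by rintro _ rfl; exact ⟨none, rfl⟩)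
  obtain ⟨b, hb⟩ := exists_isUnit_det_of_span_eq_top v hv
  have htop : ∀ c, specialSpan g c = ⊤ → ∃ w : ι → R,
      specialSpan g c ⊔ Submodule.span R {w} = ⊤ ∧
          ∀ t ∈ maximalIdeal R, t • w ∈ specialSpan g c := fun c hc =>
    ⟨0, by rw [hc, top_sup_eq], fun t _ => by rw [hc]; trivial⟩
  by_cases hn : ∃ i₀, b i₀ = none
  swap
  · push Not at hn
    obtain ⟨f, hf, hf'⟩ := specialSpan_eq_top_of_general g c₀ (eq_top_of_rows_mem _ _ hb fun i => by
      obtain ⟨a, ha⟩ := Option.ne_none_iff_exists'.1 (hn i)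
      convert eval_mem_specialSpan g c₀ a using 1
      ext j; simp [v, ha])
    exact ⟨f, hf, fun c hc => htop c (hf' c hc)⟩
  obtain ⟨i₀, hi₀⟩ := hn
  have hne : ∀ i, i ≠ i₀ → ∃ a, b i = some a := fun i hi => by
    refine Option.ne_none_iff_exists'.1 fun h => hb.ne_zero ?_
    exact Matrix.det_zero_of_row_eq hi (by ext; simp [h, hi₀])
  -- The basis found at `c₀`, allowed to vary: the row `i₀` stays `w`, the others move with the
  -- point.
  let G : Matrix ι ι (MvPolynomial σ R) := Matrix.of fun i j =>
    (b i).elim (MvPolynomial.C (w j)) fun a => g a j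
  have hG₀ : G.map (MvPolynomial.eval c₀) = Matrix.of fun i => v (b i) := by
    ext i j
    cases h : b i <;> simp [G, v, h]
  have hGw : ∀ c, G.map (MvPolynomial.eval c) i₀ = w := fun c => by
    ext j; simp [G, hi₀]
  have hGL : ∀ c i, i ≠ i₀ → G.map (MvPolynomial.eval c) i ∈ specialSpan g c := fun c i hi => by
    obtain ⟨a, ha⟩ := hne i hi
    convert eval_mem_specialSpan g c a using 1
    ext j; simp [G, ha]
  have hGtop : ∀ c, IsUnit (G.map (MvPolynomial.eval c)).det → w ∈ specialSpan g c →
      specialSpan g c = ⊤ := fun c hc hw => by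
    refine eq_top_of_rows_mem _ _ hc fun i => ?_
    by_cases hi : i = i₀
    · rw [hi, hGw]; exact hw
    · exact hGL c i hi
  have hGsup : ∀ c, IsUnit (G.map (MvPolynomial.eval c)).det →
      specialSpan g c ⊔ Submodule.span R {w} = ⊤ := fun c hc => by
    refine eq_top_of_rows_mem _ _ hc fun i => ?_
    by_cases hi : i = i₀
    · rw [hi, hGw]
      exact Submodule.mem_sup_right (Submodule.mem_span_singleton_self w)
    · exact Submodule.mem_sup_left (hGL c i hi)
  obtain ⟨r, t, ht, htmin⟩ := exists_minimal_generators_maximalIdeal R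
  have htm : ∀ l, t l ∈ maximalIdeal R := fun l => ht ▸ Ideal.subset_span ⟨l, rfl⟩
  choose u hu using fun l => Finsupp.mem_span_range_iff_exists_finsupp.1 (h₂ (t l) (htm l))
  -- The combination giving `t l • w` at `c₀`, with its coefficients frozen and its vectors moving.
  -- It stays in the span at every point, so by Cramer's rule the determinant `P l` below multiplies
  -- `w` into the span.
  let U : Fin r → ι → MvPolynomial σ R := fun l j =>
    (u l).sum fun a s => MvPolynomial.C s * g a j
  have hU : ∀ c l, (fun j => MvPolynomial.eval c (U l j)) =
      (u l).sum fun a s => s • fun j => MvPolynomial.eval c (g a j) := fun c l => by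
    ext j
    simp [U, Finsupp.sum]
  have hUL : ∀ c l, (fun j => MvPolynomial.eval c (U l j)) ∈ specialSpan g c := fun c l => by
    rw [hU]
    exact Submodule.sum_mem _ fun a _ => Submodule.smul_mem _ _ (eval_mem_specialSpan g c a)
  let P : Fin r → MvPolynomial σ R := fun l => (G.updateRow i₀ (U l)).det
  have hP : ∀ c l, MvPolynomial.eval c (P l) = ((G.map (MvPolynomial.eval c)).updateRow i₀
      fun j => MvPolynomial.eval c (U l j)).det := fun c l => by
    rw [det_eval, Matrix.map_updateRow]
    rfl
  have hPw : ∀ c, IsUnit (G.map (MvPolynomial.eval c)).det → ∀ l,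
      MvPolynomial.eval c (P l) • w ∈ specialSpan g c := fun c hc l => by
    have := det_updateRow_smul_mem _ _ hc i₀ (hGL c) _ (hUL c l)
    rwa [← hP, hGw] at this
  have hDne : MvPolynomial.eval (fun p => residue R (c₀ p))
      (MvPolynomial.map (residue R) G.det) ≠ 0 := by
    rw [← isUnit_eval_iff, det_eval, hG₀]
    exact hb
  have hD0 : MvPolynomial.map (residue R) G.det ≠ 0 := fun h => by simp [h] at hDne
  have hDunit : ∀ c : σ → R, MvPolynomial.eval (fun p => residue R (c p))
      (MvPolynomial.map (residue R) G.det) ≠ 0 → IsUnit (G.map (MvPolynomial.eval c)).det :=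
    fun c hc => by rwa [← isUnit_eval_iff, det_eval] at hc
  -- If some `P l` is nonzero modulo `𝔪`, it is generically a unit and `w` itself lies in the span.
  -- Otherwise each `P l` is a polynomial combination of the generators `t q` of `𝔪`.
  by_cases hA : ∃ l, MvPolynomial.map (residue R) (P l) ≠ 0
  · obtain ⟨l, hl⟩ := hA
    refine ⟨_, mul_ne_zero hD0 hl, fun c hc => htop c ?_⟩
    rw [map_mul] at hc
    have hD := hDunit c (left_ne_zero_of_mul hc)
    have hu := (isUnit_eval_iff c (P l)).2 (right_ne_zero_of_mul hc)
    exact hGtop c hD ((Submodule.smul_mem_iff_of_isUnit _ hu).1 (hPw c hD l))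
  push Not at hA
  have hPm : ∀ l, ∃ Q : Fin r → MvPolynomial σ R, P l = ∑ q, Q q * MvPolynomial.C (t q) :=
      fun l => by
    have h1 : P l ∈ Ideal.map MvPolynomial.C (maximalIdeal R) := by
      rw [MvPolynomial.mem_map_C_iff]
      intro m
      rw [← residue_eq_zero_iff, ← MvPolynomial.coeff_map, hA l, MvPolynomial.coeff_zero]
    rw [← ht, Ideal.map_span, ← Set.range_comp, Ideal.mem_span_range_iff_exists_fun] at h1
    obtain ⟨Q, hQ⟩ := h1
    exact ⟨Q, hQ.symm⟩
  choose Q hQ using hPm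
  have hQc : ∀ c l, MvPolynomial.eval c (P l) = ∑ q, MvPolynomial.eval c (Q l q) * t q :=
    fun c l => by rw [hQ l]; simp
  let N : Matrix (Fin r) (Fin r) (MvPolynomial σ R) := Matrix.of Q
  have hP₀ : ∀ l, MvPolynomial.eval c₀ (P l) = (G.map (MvPolynomial.eval c₀)).det * t l :=
      fun l => by
    have h1 : (fun j => MvPolynomial.eval c₀ (U l j)) = t l • w := by rw [hU]; exact hu l
    rw [hP, h1, Matrix.det_updateRow_smul]
    conv_lhs => rw [← hGw c₀]
    rw [Matrix.updateRow_eq_self, mul_comm]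
  -- Comparing `P l = ∑ Q l q * t q` with `P l = det G * t l` at `c₀`: the generators `t` are
  -- minimal, so the coefficients agree modulo `𝔪`. Hence `N` is invertible at `c₀`, and so
  -- generically.
  have hN₀ : (N.map (MvPolynomial.eval c₀)).map (residue R) =
      Matrix.diagonal fun _ => residue R (G.map (MvPolynomial.eval c₀)).det := by
    ext l q
    have h1 := htmin (fun q => MvPolynomial.eval c₀ (Q l q) -
      if l = q then (G.map (MvPolynomial.eval c₀)).det else 0) (by
        simp only [sub_mul, Finset.sum_sub_distrib, ← hQc, hP₀]
        simp) q
    rw [← residue_eq_zero_iff, map_sub, sub_eq_zero] at h1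
    simp only [Matrix.map_apply, Matrix.diagonal_apply]
    refine h1.trans ?_
    split_ifs <;> simp
  have hNne : MvPolynomial.eval (fun p => residue R (c₀ p))
      (MvPolynomial.map (residue R) N.det) ≠ 0 := by
    rw [← residue_eval, det_eval, RingHom.map_det]
    have : (residue R).mapMatrix (N.map (MvPolynomial.eval c₀)) = _ := hN₀
    rw [this, Matrix.det_diagonal]
    exact Finset.prod_ne_zero_iff.2 fun _ _ => (residue_ne_zero_iff_isUnit _).2 (hDunit _ hDne)
  refine ⟨MvPolynomial.map (residue R) G.det * MvPolynomial.map (residue R) N.det,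
    mul_ne_zero hD0 fun h => by simp [h] at hNne, fun c hc => ⟨w, ?_⟩⟩
  rw [map_mul] at hc
  have hD := hDunit c (left_ne_zero_of_mul hc)
  have hN := (isUnit_eval_iff c N.det).2 (right_ne_zero_of_mul hc)
  rw [det_eval] at hN
  refine ⟨hGsup c hD, ?_⟩
  have hle : maximalIdeal R ≤ Submodule.comap (LinearMap.toSpanSingleton R _ w)
      (specialSpan g c) := by
    rw [← ht, Ideal.span_le]
    rintro _ ⟨q, rfl⟩
    -- Inverting `N` recovers the generators of `𝔪` from the values of `P`, all of which multiply
    -- `w` into the span.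
    have h1 : t = Matrix.mulVec (N.map (MvPolynomial.eval c))⁻¹
        fun l => MvPolynomial.eval c (P l) := by
      have h2 : (fun l => MvPolynomial.eval c (P l)) =
          Matrix.mulVec (N.map (MvPolynomial.eval c)) t := by
        ext l
        rw [hQc]
        rfl
      rw [h2, Matrix.mulVec_mulVec, Matrix.nonsing_inv_mul _ hN, Matrix.one_mulVec]
    have h3 : t q = ∑ l, (N.map (MvPolynomial.eval c))⁻¹ q l * MvPolynomial.eval c (P l) :=
      congrFun h1 q
    simp only [SetLike.mem_coe, Submodule.mem_comap, LinearMap.toSpanSingleton_apply]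
    rw [h3, Finset.sum_smul]
    refine Submodule.sum_mem _ fun l _ => ?_
    rw [mul_smul]
    exact Submodule.smul_mem _ _ (hPw c hD l)
  exact fun s hs => hle hs

/-! ### Openness for products of ideals -/

/-- The quotient `A / (A ∩ B)` is cyclic and killed by the maximal ideal, i.e. its length is at
most one. -/
def QuotLengthLEOne {R : Type*} [CommRing R] [IsLocalRing R] (A B : Ideal R) : Prop :=
  ∃ w ∈ A, A ≤ B ⊔ Ideal.span {w} ∧ maximalIdeal R * A ≤ B

theorem QuotLengthLEOne.mono {R : Type*} [CommRing R] [IsLocalRing R] {A B B' : Ideal R}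
    (h : QuotLengthLEOne A B) (hB : B ≤ B') : QuotLengthLEOne A B' := by
  obtain ⟨w, hw, h1, h2⟩ := h
  exact ⟨w, hw, h1.trans (sup_le_sup_right hB _), h2.trans hB⟩

/-- The elements `∑ j, c (i, j) * a j` with coefficients `c`. -/
def linearCombos {R : Type*} [CommRing R] {t s : ℕ} (a : Fin s → R) (c : Fin t × Fin s → R) :
    Fin t → R :=
  fun i => ∑ j, c (i, j) * a j

/-- The linear map sending `y` to `∑ y (j, μ) * (a j * b μ)`. -/
def productMap {R : Type*} [CommRing R] {s m : ℕ} (a : Fin s → R) (b : Fin m → R) :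
    (Fin s × Fin m → R) →ₗ[R] R :=
  Fintype.linearCombination R fun p => a p.1 * b p.2

theorem range_productMap {R : Type*} [CommRing R] {s m : ℕ} (a : Fin s → R) (b : Fin m → R) :
    LinearMap.range (productMap a b) =
      Ideal.span (Set.range a) * Ideal.span (Set.range b) := by
  rw [productMap, Fintype.range_linearCombination, Ideal.span_mul_span', ← Ideal.submodule_span_eq]
  congr 1
  ext x
  simp [Set.mem_mul]

/-- Polynomial vectors spanning the preimage of `(x) N + K` under `productMap`, where the `x i` are
general linear combinations. -/
noncomputable def productRelations {R : Type*} [CommRing R] {s m : ℕ} (t : ℕ) (a : Fin s → R) (b : Fin m → R)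
    (K : Ideal R) : (Fin t × Fin m) ⊕ (Submodule.comap (productMap a b) K) → Fin s × Fin m →
      MvPolynomial (Fin t × Fin s) R
  | .inl q, p => if p.2 = q.2 then MvPolynomial.X (q.1, p.1) else 0
  | .inr y, p => MvPolynomial.C (y.1 p)

/-- This presents `I N / (I N ∩ ((x) N + K))` as the cokernel of a family that is polynomial in the
coefficients of `x`, so that the openness results for such families apply. -/
theorem specialSpan_productRelations {R : Type*} [CommRing R] {s m t : ℕ} (a : Fin s → R)
    (b : Fin m → R) (K : Ideal R) (c : Fin t × Fin s → R) :
    specialSpan (productRelations t a b K) c = Submodule.comap (productMap a b)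
      (Ideal.span (Set.range (linearCombos a c)) * Ideal.span (Set.range b) + K) := by
  have hinl : ∀ i μ, productMap a b (fun p => MvPolynomial.eval c
      (productRelations t a b K (.inl (i, μ)) p)) = linearCombos a c i * b μ := by
    intro i μ
    simp only [productMap, Fintype.linearCombination_apply, productRelations, linearCombos,
      Fintype.sum_prod_type, Finset.sum_mul]
    refine Finset.sum_congr rfl fun j _ => ?_
    rw [Finset.sum_eq_single μ]
    · simp [mul_assoc]
    · intro μ' _ h
      simp [h]
    · simp
  have hinr : ∀ y : Submodule.comap (productMap a b) K, (fun p => MvPolynomial.eval c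
      (productRelations t a b K (.inr y) p)) = y.1 := by
    intro y
    ext p
    simp [productRelations]
  apply le_antisymm
  · rw [specialSpan, Submodule.span_le]
    rintro _ ⟨q, rfl⟩
    rw [SetLike.mem_coe, Submodule.mem_comap]
    rcases q with ⟨i, μ⟩ | y
    · rw [hinl]
      exact Submodule.mem_sup_left (Ideal.mul_mem_mul (Ideal.subset_span ⟨i, rfl⟩)
        (Ideal.subset_span ⟨μ, rfl⟩))
    · beta_reduce
      rw [hinr]
      exact Submodule.mem_sup_right y.2
  · have hle : Ideal.span (Set.range (linearCombos a c)) * Ideal.span (Set.range b) ≤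
        Submodule.map (productMap a b) (specialSpan (productRelations t a b K) c) := by
      rw [Ideal.span_mul_span', Ideal.span_le]
      rintro _ ⟨_, ⟨i, rfl⟩, _, ⟨μ, rfl⟩, rfl⟩
      have h := Submodule.mem_map_of_mem (f := productMap a b)
        (eval_mem_specialSpan (productRelations t a b K) c (.inl (i, μ)))
      rw [hinl] at h
      exact h
    intro y hy
    rw [Submodule.mem_comap] at hy
    obtain ⟨z, hz, κ, hκ, hzκ⟩ := Submodule.mem_sup.1 hy
    obtain ⟨y', hy', rfl⟩ := hle hz
    have hd : y - y' ∈ Submodule.comap (productMap a b) K := by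
      rw [Submodule.mem_comap, map_sub, ← hzκ, add_sub_cancel_left]
      exact hκ
    have := eval_mem_specialSpan (productRelations t a b K) c (.inr ⟨y - y', hd⟩)
    rw [hinr] at this
    simpa using add_mem this hy'

/-- If `I N ⊆ (x) N + K` for some elements `x` of `I`, then it holds for general elements. -/
theorem mul_le_of_general {R : Type*} [CommRing R] [IsLocalRing R] {s m t : ℕ} (a : Fin s → R)
    (b : Fin m → R) (K : Ideal R) (c₀ : Fin t × Fin s → R)
    (h : Ideal.span (Set.range a) * Ideal.span (Set.range b) ≤
      Ideal.span (Set.range (linearCombos a c₀)) * Ideal.span (Set.range b) + K) :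
    ∃ f : MvPolynomial (Fin t × Fin s) (ResidueField R), f ≠ 0 ∧
      ∀ c : Fin t × Fin s → R, MvPolynomial.eval (fun p => residue R (c p)) f ≠ 0 →
        Ideal.span (Set.range a) * Ideal.span (Set.range b) ≤
          Ideal.span (Set.range (linearCombos a c)) * Ideal.span (Set.range b) + K := by
  have key : ∀ c : Fin t × Fin s → R, specialSpan (productRelations t a b K) c = ⊤ ↔
      Ideal.span (Set.range a) * Ideal.span (Set.range b) ≤
        Ideal.span (Set.range (linearCombos a c)) * Ideal.span (Set.range b) + K := by
    intro c
    rw [specialSpan_productRelations, ← range_productMap a b, LinearMap.range_le_iff_comap]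
  obtain ⟨f, hf, hf'⟩ := specialSpan_eq_top_of_general _ c₀ ((key c₀).2 h)
  exact ⟨f, hf, fun c hc => (key c).1 (hf' c hc)⟩

/-- If `I N / ((x) N + K)` has length at most one for some elements `x` of `I`, then so it does for
general elements. -/
theorem quotLengthLEOne_of_general {R : Type*} [CommRing R] [IsLocalRing R] [IsNoetherianRing R]
    {s m t : ℕ} (a : Fin s → R) (b : Fin m → R) (K : Ideal R) (c₀ : Fin t × Fin s → R)
    (h : QuotLengthLEOne (Ideal.span (Set.range a) * Ideal.span (Set.range b))
      (Ideal.span (Set.range (linearCombos a c₀)) * Ideal.span (Set.range b) + K)) :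
    ∃ f : MvPolynomial (Fin t × Fin s) (ResidueField R), f ≠ 0 ∧
      ∀ c : Fin t × Fin s → R, MvPolynomial.eval (fun p => residue R (c p)) f ≠ 0 →
        QuotLengthLEOne (Ideal.span (Set.range a) * Ideal.span (Set.range b))
          (Ideal.span (Set.range (linearCombos a c)) * Ideal.span (Set.range b) + K) := by
  obtain ⟨w, hw, h1, h2⟩ := h
  rw [← range_productMap a b] at hw h1
  obtain ⟨w, rfl⟩ := hw
  obtain ⟨f, hf, hf'⟩ := specialSpan_sup_eq_top_of_general (productRelations t a b K) c₀ w (by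
    rw [eq_top_iff]
    rintro y -
    obtain ⟨z, hz, z', hz', hzz⟩ := Submodule.mem_sup.1 (h1 ⟨y, rfl⟩)
    obtain ⟨r, rfl⟩ := Ideal.mem_span_singleton'.1 hz'
    refine Submodule.mem_sup.2 ⟨y - r • w, ?_, r • w,
      Submodule.smul_mem _ _ (Submodule.mem_span_singleton_self w), sub_add_cancel _ _⟩
    rw [specialSpan_productRelations, Submodule.mem_comap, map_sub, map_smul, ← hzz, smul_eq_mul,
      add_sub_cancel_right]
    exact hz) (fun τ hτ => by
    rw [specialSpan_productRelations, Submodule.mem_comap, map_smul]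
    refine h2 (Ideal.mul_mem_mul hτ ?_)
    rw [← range_productMap a b]
    exact ⟨w, rfl⟩)
  refine ⟨f, hf, fun c hc => ?_⟩
  obtain ⟨w, h1, h2⟩ := hf' c hc
  rw [specialSpan_productRelations] at h1 h2
  rw [← range_productMap a b]
  refine ⟨productMap a b w, ⟨w, rfl⟩, ?_, ?_⟩
  · rintro _ ⟨y, rfl⟩
    obtain ⟨z, hz, z', hz', rfl⟩ := Submodule.mem_sup.1 (show y ∈ _ from h1 ▸ Submodule.mem_top)
    obtain ⟨r, rfl⟩ := Submodule.mem_span_singleton.1 hz'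
    rw [map_add, map_smul]
    exact add_mem (Submodule.mem_sup_left hz) (Submodule.mem_sup_right
      (Ideal.mul_mem_left _ _ (Ideal.mem_span_singleton_self _)))
  · rw [Ideal.mul_le]
    rintro τ hτ _ ⟨y, rfl⟩
    obtain ⟨z, hz, z', hz', rfl⟩ := Submodule.mem_sup.1 (show y ∈ _ from h1 ▸ Submodule.mem_top)
    obtain ⟨r, rfl⟩ := Submodule.mem_span_singleton.1 hz'
    rw [map_add, map_smul, mul_add, smul_eq_mul, mul_left_comm]
    refine add_mem (Ideal.mul_mem_left _ _ hz) (Ideal.mul_mem_left _ _ ?_)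
    have := h2 τ hτ
    rwa [Submodule.mem_comap, map_smul] at this

/-! ### Length conditions as containments of ideals -/

theorem length_le_one_iff {R N : Type*} [CommRing R] [IsLocalRing R] [AddCommGroup N]
    [Module R N] : Module.length R N ≤ 1 ↔
      ∃ w : N, Submodule.span R {w} = ⊤ ∧ ∀ t ∈ maximalIdeal R, t • w = 0 := by
  constructor
  · intro h
    rcases Order.le_one_iff.1 h with h | h
    · have := Module.length_eq_zero_iff.1 h
      exact ⟨0, Subsingleton.elim _ _, fun t _ => smul_zero t⟩
    · have := Module.length_eq_one_iff.1 h
      have := IsSimpleModule.nontrivial R N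
      obtain ⟨w, hw⟩ := exists_ne (0 : N)
      have h1 : Module.annihilator R N = maximalIdeal R :=
        eq_maximalIdeal (IsSimpleModule.annihilator_isMaximal)
      exact ⟨w, IsSimpleModule.span_singleton_eq_top R hw, fun t ht =>
        Module.mem_annihilator.1 (h1 ▸ ht) w⟩
  · rintro ⟨w, h1, h2⟩
    let g : (R ⧸ maximalIdeal R) →ₗ[R] N :=
      Submodule.liftQ _ (LinearMap.toSpanSingleton R N w) fun t ht => h2 t ht
    have hg : Function.Surjective g := by
      intro y
      obtain ⟨r, rfl⟩ := Submodule.mem_span_singleton.1 (show y ∈ _ from h1 ▸ Submodule.mem_top)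
      exact ⟨Submodule.Quotient.mk r, Submodule.liftQ_apply _ _ _⟩
    refine (Module.length_le_of_surjective g hg).trans ?_
    have : IsSimpleModule R (R ⧸ maximalIdeal R) :=
      isSimpleModule_iff_isCoatom.2 (maximalIdeal.isMaximal R).out
    rw [Module.length_eq_one]

/-- Length over `R / Q` equals length over `R`, so both notions of stretchedness become containments
between ideals of the fixed ring `R`. -/
theorem lengthQuot_map_le_one_iff {R : Type*} [CommRing R] [IsLocalRing R] (A B Q : Ideal R) :
    lengthQuot (A.map (Ideal.Quotient.mk Q)) (B.map (Ideal.Quotient.mk Q)) ≤ 1 ↔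
      QuotLengthLEOne A (B + Q) := by
  have hmem : ∀ x, Ideal.Quotient.mk Q x ∈ B.map (Ideal.Quotient.mk Q) ↔ x ∈ B + Q := fun x => by
    rw [← Ideal.mem_comap, Ideal.comap_map_of_surjective _ Ideal.Quotient.mk_surjective,
      ← RingHom.ker_eq_comap_bot, Ideal.mk_ker]
    rfl
  rw [lengthQuot, ← Module.length_eq_of_surjective (S := R) (R := R ⧸ Q)
    Ideal.Quotient.mk_surjective, length_le_one_iff]
  constructor
  · rintro ⟨w, h1, h2⟩
    obtain ⟨⟨w, hw⟩, rfl⟩ := Submodule.Quotient.mk_surjective _ w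
    obtain ⟨w, hwA, rfl⟩ := (Ideal.mem_map_iff_of_surjective _ Ideal.Quotient.mk_surjective).1 hw
    have hle : A ≤ (B + Q) ⊔ Ideal.span {w} := by
      intro x hx
      obtain ⟨r, hr⟩ := Submodule.mem_span_singleton.1 (show
        (Submodule.Quotient.mk ⟨Ideal.Quotient.mk Q x, Ideal.mem_map_of_mem _ hx⟩ :
          (A.map (Ideal.Quotient.mk Q)) ⧸ Submodule.comap (A.map (Ideal.Quotient.mk Q)).subtype
            (B.map (Ideal.Quotient.mk Q))) ∈ _ from h1 ▸ Submodule.mem_top)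
      rw [← Submodule.Quotient.mk_smul, eq_comm, Submodule.Quotient.eq] at hr
      have h3 : Ideal.Quotient.mk Q (x - r * w) ∈ B.map (Ideal.Quotient.mk Q) := hr
      rw [hmem] at h3
      have := add_mem (Submodule.mem_sup_left h3) (Submodule.mem_sup_right (S := B + Q)
        (Ideal.mul_mem_left _ r (Ideal.mem_span_singleton_self w)))
      simpa using this
    have hm : ∀ t ∈ maximalIdeal R, t * w ∈ B + Q := by
      intro t ht
      have h3 := h2 t ht
      rw [← Submodule.Quotient.mk_smul, Submodule.Quotient.mk_eq_zero] at h3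
      exact (hmem _).1 h3
    refine ⟨w, hwA, hle, Ideal.mul_le.2 fun t ht x hx => ?_⟩
    obtain ⟨y, hy, z, hz, rfl⟩ := Submodule.mem_sup.1 (hle hx)
    obtain ⟨r, rfl⟩ := Ideal.mem_span_singleton'.1 hz
    rw [mul_add, mul_left_comm]
    exact add_mem (Ideal.mul_mem_left _ _ hy) (Ideal.mul_mem_left _ _ (hm t ht))
  · rintro ⟨w, hw, h1, h2⟩
    refine ⟨Submodule.Quotient.mk ⟨Ideal.Quotient.mk Q w, Ideal.mem_map_of_mem _ hw⟩, ?_, ?_⟩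
    · rw [eq_top_iff]
      rintro x -
      obtain ⟨⟨x, hx⟩, rfl⟩ := Submodule.Quotient.mk_surjective _ x
      obtain ⟨x, hxA, rfl⟩ := (Ideal.mem_map_iff_of_surjective _ Ideal.Quotient.mk_surjective).1 hx
      obtain ⟨y, hy, z, hz, rfl⟩ := Submodule.mem_sup.1 (h1 hxA)
      obtain ⟨r, rfl⟩ := Ideal.mem_span_singleton'.1 hz
      refine Submodule.mem_span_singleton.2 ⟨r, ?_⟩
      rw [← Submodule.Quotient.mk_smul, eq_comm, Submodule.Quotient.eq]
      have h3 := (hmem (y + r * w - r * w)).2 (by simpa using hy)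
      rw [map_sub] at h3
      exact h3
    · intro t ht
      rw [← Submodule.Quotient.mk_smul, Submodule.Quotient.mk_eq_zero]
      exact (hmem (t * w)).2 (h2 (Ideal.mul_mem_mul ht hw))

theorem hilbertFun_two_le_one_iff {R : Type*} [CommRing R] [IsLocalRing R] (I H : Ideal R) :
    hilbertFun (I.map (Ideal.Quotient.mk H)) 2 ≤ 1 ↔ QuotLengthLEOne (I ^ 2) (I ^ 3 + H) := by
  rw [hilbertFun, ← Ideal.map_pow, ← Ideal.map_pow, lengthQuot_map_le_one_iff]

theorem jStretchedLength_le_one_iff {R : Type*} [CommRing R] [IsLocalRing R] (I Q : Ideal R)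
    (x : R) : jStretchedLength I Q x ≤ 1 ↔
      QuotLengthLEOne (I ^ 2) (Ideal.span {x} * I + I ^ 3 + Q) := by
  rw [jStretchedLength, ← lengthQuot_map_le_one_iff]
  simp only [Submodule.add_eq_sup, Ideal.map_sup, Ideal.map_mul, Ideal.map_pow, Ideal.map_span,
    Set.image_singleton]

/-! ### Reductions generated by `dim R` elements are minimal -/

theorem IsReduction.trans {R : Type*} [CommRing R] {J H I : Ideal R} (h₁ : IsReduction J H)
    (h₂ : IsReduction H I) : IsReduction J I := by
  obtain ⟨h₁, t, ht⟩ := h₁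
  obtain ⟨h₂, r, hr⟩ := h₂
  have h : ∀ n, I ^ (r + n) = H ^ n * I ^ r := by
    intro n
    induction n with
    | zero => simp
    | succ n ih => rw [← add_assoc, pow_succ, ih, mul_assoc, ← pow_succ, hr, ← mul_assoc, pow_succ]
  refine ⟨h₁.trans h₂, r + t, ?_⟩
  rw [add_assoc, h, h, ht, mul_assoc]

theorem IsReduction.radical_eq {R : Type*} [CommRing R] {J I : Ideal R} (h : IsReduction J I) :
    J.radical = I.radical := by
  obtain ⟨h₁, r, hr⟩ := h
  refine le_antisymm (Ideal.radical_mono h₁) ?_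
  rw [← Ideal.radical_pow I r.succ_ne_zero, hr]
  exact Ideal.radical_mono Ideal.mul_le_left

/-- An ideal whose radical is the maximal ideal needs at least `dim R` generators. -/
theorem ringKrullDim_le_of_radical_span_eq {R : Type*} [CommRing R] [IsLocalRing R]
    [IsNoetherianRing R] {ι : Type*} [Fintype ι] (x : ι → R)
    (hx : (Ideal.span (Set.range x)).radical = maximalIdeal R) :
    ringKrullDim R ≤ (Fintype.card ι : ℕ) := by
  classical
  have h : maximalIdeal R ∈ (Ideal.span (Set.range x)).minimalPrimes := by
    rw [← Ideal.radical_minimalPrimes, hx, Ideal.minimalPrimes_eq_subsingleton_self]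
    rfl
  rw [← maximalIdeal_height_eq_ringKrullDim]
  have h1 := Ideal.height_le_card_of_mem_minimalPrimes_span_finset
    (s := Finset.univ.image x) (by simpa using h)
  have h2 : ((Finset.univ.image x).card : ℕ∞) ≤ (Fintype.card ι : ℕ) :=
    Nat.cast_le.2 Finset.card_image_le
  exact_mod_cast h1.trans h2

/-- A reduction of an ideal primary to the maximal ideal that is generated by `dim R` elements is
a minimal reduction. -/
theorem isMinimalReduction_of_card_le {R : Type*} [CommRing R] [IsLocalRing R]
    [IsNoetherianRing R] {I : Ideal R} (hI : I.radical = maximalIdeal R) {n : ℕ} (x : Fin n → R)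
    (hn : (n : WithBot ℕ∞) ≤ ringKrullDim R) (hx : IsReduction (Ideal.span (Set.range x)) I) :
    IsMinimalReduction (Ideal.span (Set.range x)) I := by
  classical
  refine ⟨hx, fun L hL hLx => ?_⟩
  by_contra hcon
  let L' : Submodule R (Fin n → R) := Submodule.comap (Fintype.linearCombination R x) L
  let v : L' → Fin n → ResidueField R := fun y i => residue R (y.1 i)
  -- If the coefficient vectors of elements of `L` span modulo `𝔪`, then `L` is all of `(x)`.
  -- Otherwise a nonzero functional `φ` kills their residues, and `L` lies, up to `𝔪 (x)`, in an
  -- ideal with one generator fewer.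
  by_cases hv : Submodule.span (ResidueField R) (Set.range v) = ⊤
  · obtain ⟨b, hb⟩ := exists_det_ne_zero_of_span_eq_top v hv
    have htop : L' = ⊤ := eq_top_of_rows_mem L' (Matrix.of fun i => (b i).1) (by
      rw [← residue_ne_zero_iff_isUnit, RingHom.map_det]
      exact hb) fun i => (b i).2
    refine hcon ?_
    rw [← Ideal.submodule_span_eq, ← Fintype.range_linearCombination R x,
      LinearMap.range_le_iff_comap]
    exact htop
  · obtain ⟨φ, hφ, hφv⟩ := Submodule.exists_le_ker_of_lt_top _ (lt_top_iff_ne_top.2 hv)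
    obtain ⟨j, hj⟩ : ∃ j, φ (Pi.single j 1) ≠ 0 := by
      by_contra! h
      exact hφ (LinearMap.pi_ext' fun i => LinearMap.ext_ring (by simpa using h i))
    choose p hp using fun i => residue_surjective (R := R) (φ (Pi.single i 1))
    have hφp : ∀ y : Fin n → R, φ (fun i => residue R (y i)) = residue R (∑ i, y i * p i) := by
      intro y
      rw [LinearMap.pi_apply_eq_sum_univ φ]
      simp only [map_sum, map_mul, hp, smul_eq_mul]
      refine Finset.sum_congr rfl fun i _ => ?_
      congr 2
      ext i'
      simp [Pi.single_apply, eq_comm]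
    have hpj : IsUnit (p j) := by rw [← residue_ne_zero_iff_isUnit, hp]; exact hj
    obtain ⟨q, hq⟩ := hpj.exists_right_inv
    -- Since `q` inverts `p j`, the coefficient vectors of the `y i` lie in the kernel of `φ` and
    -- span it modulo `𝔪`.
    let y : {i // i ≠ j} → R := fun i => x i - p i * q * x j
    have hyJ : Ideal.span (Set.range y) ≤ Ideal.span (Set.range x) := by
      rw [Ideal.span_le]
      rintro _ ⟨i, rfl⟩
      exact sub_mem (Ideal.subset_span ⟨_, rfl⟩) (Ideal.mul_mem_left _ _ (Ideal.subset_span ⟨_, rfl⟩))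
    have hLy : L ≤ Ideal.span (Set.range y) ⊔ maximalIdeal R * Ideal.span (Set.range x) := by
      intro l hl
      obtain ⟨r, rfl⟩ := Ideal.mem_span_range_iff_exists_fun.1 (hLx hl)
      have h1 : ∑ i, r i * p i ∈ maximalIdeal R := by
        rw [← residue_eq_zero_iff, ← hφp]
        exact hφv (Submodule.subset_span ⟨⟨r, by
          simpa [L', Fintype.linearCombination_apply] using hl⟩, rfl⟩)
      have h2 : ∑ i, r i * x i = ∑ i : {i // i ≠ j}, r i * y i + (∑ i, r i * p i) * (q * x j) := by
        have h3 : ∑ i : {i // i ≠ j}, r i * y i = ∑ i, r i * (x i - p i * q * x j) := by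
          rw [Fintype.sum_eq_add_sum_subtype_ne _ j, hq]
          simp [y]
        rw [h3, Finset.sum_mul, ← Finset.sum_add_distrib]
        exact Finset.sum_congr rfl fun i _ => by ring
      rw [h2]
      exact add_mem (Submodule.mem_sup_left (Submodule.sum_mem _ fun i _ =>
        Ideal.mul_mem_left _ _ (Ideal.subset_span ⟨i, rfl⟩)))
        (Submodule.mem_sup_right (Ideal.mul_mem_mul h1
          (Ideal.mul_mem_left _ _ (Ideal.subset_span ⟨j, rfl⟩))))
    -- By Nakayama the term in `𝔪 (x)` does not matter, so `(y)` is a reduction of `I` with too few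
    -- generators to have radical `𝔪`.
    have hyred : IsReduction (Ideal.span (Set.range y)) I := by
      obtain ⟨hLI, r, hr⟩ := hL
      refine ⟨hyJ.trans hx.1, r, le_antisymm ?_ ?_⟩
      · refine Submodule.le_of_le_smul_of_le_jacobson_bot (I := maximalIdeal R)
          (IsNoetherian.noetherian _) (maximalIdeal_le_jacobson _) ?_
        conv_lhs => rw [hr]
        refine (Ideal.mul_mono_left hLy).trans ?_
        rw [Ideal.sup_mul, mul_assoc, smul_eq_mul]
        refine sup_le_sup_left (Ideal.mul_mono_right ?_) _
        rw [pow_succ']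
        exact Ideal.mul_mono_left hx.1
      · rw [pow_succ']
        exact Ideal.mul_mono_left (hyJ.trans hx.1)
    have h1 := ringKrullDim_le_of_radical_span_eq y (by rw [hyred.radical_eq, hI])
    have h2 := hn.trans h1
    rw [Fintype.card_subtype_compl, Fintype.card_fin, Fintype.card_subtype_eq] at h2
    have h3 : n ≤ n - 1 := by exact_mod_cast h2
    -- The subtraction `n - 1` is truncated; the index `j` excludes `n = 0`.
    have := j.pos
    omega

/-! ### Lengths of quotients by powers of an ideal -/

/-- The value of the monomial `μ` at `a`. -/
def symProd {S : Type*} [CommMonoid S] {s N : ℕ} (a : Fin s → S) (μ : Sym (Fin s) N) : S :=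
  ((μ : Multiset (Fin s)).map a).prod

theorem symProd_cons {S : Type*} [CommMonoid S] {s N : ℕ} (a : Fin s → S) (i : Fin s)
    (μ : Sym (Fin s) N) : symProd a (i ::ₛ μ) = a i * symProd a μ := by
  change ((i ::ₘ (μ : Multiset (Fin s))).map a).prod = _
  rw [Multiset.map_cons, Multiset.prod_cons]
  rfl

theorem span_range_pow_eq {R : Type*} [CommRing R] {s : ℕ} (a : Fin s → R) (N : ℕ) :
    Ideal.span (Set.range a) ^ N =
      Ideal.span (Set.range (symProd a : Sym (Fin s) N → R)) := by
  induction N with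
  | zero =>
    rw [pow_zero, Ideal.one_eq_top, eq_comm, Ideal.eq_top_iff_one]
    refine Ideal.subset_span ⟨Sym.nil, ?_⟩
    simp [symProd]
  | succ N ih =>
    rw [pow_succ', ih, Ideal.span_mul_span']
    congr 1
    ext x
    constructor
    · rintro ⟨_, ⟨i, rfl⟩, _, ⟨μ, rfl⟩, rfl⟩
      exact ⟨i ::ₛ μ, symProd_cons a i μ⟩
    · rintro ⟨μ, rfl⟩
      obtain ⟨i, μ, rfl⟩ := Sym.exists_eq_cons_of_succ μ
      exact ⟨_, ⟨i, rfl⟩, _, ⟨μ, rfl⟩, (symProd_cons a i μ).symm⟩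

theorem length_quotient_eq_add {R : Type*} [CommRing R] {A B : Ideal R} (h : B ≤ A) :
    Module.length R (R ⧸ B) = lengthQuot A B + Module.length R (R ⧸ A) := by
  refine Module.length_eq_add_of_exact
    (Submodule.mapQ (Submodule.comap A.subtype B) B A.subtype le_rfl)
    (Submodule.factor h) ?_ ?_ ?_
  · rw [← LinearMap.ker_eq_bot, Submodule.ker_mapQ]
    exact Submodule.mkQ_map_self _
  · exact Submodule.factor_surjective h
  · rw [LinearMap.exact_iff, Submodule.range_mapQ, Submodule.range_subtype]
    ext x
    obtain ⟨x, rfl⟩ := Submodule.Quotient.mk_surjective _ x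
    simp only [LinearMap.mem_ker, Submodule.mem_map]
    constructor
    · intro hx
      exact ⟨x, (Submodule.Quotient.mk_eq_zero A).1 hx, rfl⟩
    · rintro ⟨y, hy, hyx⟩
      rw [← hyx]
      exact (Submodule.Quotient.mk_eq_zero A).2 hy

/-- The `d.multichoose N` monomials of degree `N` in the generators generate `J ^ N / J ^ (N + 1)`
over `R / J`. -/
theorem lengthQuot_pow_succ_le {R : Type*} [CommRing R] {d : ℕ} (q : Fin d → R) (N : ℕ) :
    lengthQuot (Ideal.span (Set.range q) ^ N) (Ideal.span (Set.range q) ^ (N + 1)) ≤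
      d.multichoose N * Module.length R (R ⧸ Ideal.span (Set.range q)) := by
  classical
  set J := Ideal.span (Set.range q) with hJ
  have hmem : ∀ μ : Sym (Fin d) N, symProd q μ ∈ J ^ N := fun μ => by
    rw [hJ, span_range_pow_eq]
    exact Ideal.subset_span ⟨μ, rfl⟩
  let T := ↥(J ^ N) ⧸ Submodule.comap (J ^ N).subtype (J ^ (N + 1))
  let g : Sym (Fin d) N → (R ⧸ J) →ₗ[R] T := fun μ =>
    Submodule.liftQ J (LinearMap.toSpanSingleton R T (Submodule.Quotient.mk ⟨symProd q μ, hmem μ⟩))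
      (by
        intro r hr
        rw [LinearMap.mem_ker, LinearMap.toSpanSingleton_apply, ← Submodule.Quotient.mk_smul,
          Submodule.Quotient.mk_eq_zero, Submodule.mem_comap]
        change r * symProd q μ ∈ J ^ (N + 1)
        rw [pow_succ']
        exact Ideal.mul_mem_mul hr (hmem μ))
  let G : (Sym (Fin d) N → R ⧸ J) →ₗ[R] T := ∑ μ, (g μ).comp (LinearMap.proj μ)
  have hG : Function.Surjective G := by
    intro z
    obtain ⟨⟨z, hz⟩, rfl⟩ := Submodule.Quotient.mk_surjective _ z
    have hz' := hz
    rw [hJ, span_range_pow_eq, Ideal.mem_span_range_iff_exists_fun] at hz'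
    obtain ⟨r, hr⟩ := hz'
    refine ⟨fun μ => Submodule.Quotient.mk (r μ), ?_⟩
    have h1 : ∀ μ, g μ (Submodule.Quotient.mk (r μ)) =
        Submodule.Quotient.mk (r μ • ⟨symProd q μ, hmem μ⟩) := fun μ => by
      refine (Submodule.liftQ_apply _ _ _).trans ?_
      rw [LinearMap.toSpanSingleton_apply, Submodule.Quotient.mk_smul]
    simp only [G, LinearMap.sum_apply, LinearMap.comp_apply, LinearMap.proj_apply, h1]
    rw [← Submodule.mkQ_apply]
    simp only [← Submodule.mkQ_apply]
    rw [← map_sum]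
    congr 1
    apply Subtype.ext
    simp [hr]
  refine (Module.length_le_of_surjective G hG).trans ?_
  rw [Module.length_pi, ENat.card_eq_coe_fintype_card, Sym.card_sym_eq_multichoose,
    Fintype.card_fin]

/-- When all relations have coefficients in `𝔪`, reading coefficients modulo `𝔪` is well defined and
maps the quotient onto a residue field vector space with one dimension per monomial. -/
theorem multichoose_le_lengthQuot {R : Type*} [CommRing R] [IsLocalRing R] {s : ℕ} (a : Fin s → R)
    (N : ℕ) (h : ∀ r : Sym (Fin s) N → R,
      ∑ μ, r μ * symProd a μ ∈ Ideal.span (Set.range a) ^ (N + 1) → ∀ μ, r μ ∈ maximalIdeal R) :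
    (s.multichoose N : ℕ∞) ≤
      lengthQuot (Ideal.span (Set.range a) ^ N) (Ideal.span (Set.range a) ^ (N + 1)) := by
  classical
  set J := Ideal.span (Set.range a) with hJ
  have hmem : ∀ μ : Sym (Fin s) N, symProd a μ ∈ J ^ N := fun μ => by
    rw [hJ, span_range_pow_eq]
    exact Ideal.subset_span ⟨μ, rfl⟩
  let φ : (Sym (Fin s) N → R) →ₗ[R] ↥(J ^ N) :=
    Fintype.linearCombination R fun μ => ⟨symProd a μ, hmem μ⟩
  have hφ' : ∀ r, (φ r : R) = ∑ μ, r μ * symProd a μ := fun r => by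
    simp [φ, Fintype.linearCombination_apply]
  have hφ : Function.Surjective φ := by
    rintro ⟨z, hz⟩
    have hz' := hz
    rw [hJ, span_range_pow_eq, Ideal.mem_span_range_iff_exists_fun] at hz'
    obtain ⟨r, hr⟩ := hz'
    exact ⟨r, Subtype.ext ((hφ' r).trans hr)⟩
  let F := (Submodule.comap (J ^ N).subtype (J ^ (N + 1))).mkQ.comp φ
  have hF : Function.Surjective F := (Submodule.mkQ_surjective _).comp hφ
  let ψ : (Sym (Fin s) N → R) →ₗ[R] (Sym (Fin s) N → R ⧸ maximalIdeal R) :=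
    (maximalIdeal R).mkQ.compLeft _
  have hψ : Function.Surjective ψ := by
    intro y
    choose r hr using fun μ => Submodule.mkQ_surjective _ (y μ)
    exact ⟨r, funext hr⟩
  have hker : LinearMap.ker F ≤ LinearMap.ker ψ := by
    intro r hr
    have h1 : ∑ μ, r μ * symProd a μ ∈ J ^ (N + 1) := by
      rw [← hφ']
      have h2 : φ r ∈ Submodule.comap (J ^ N).subtype (J ^ (N + 1)) :=
        (Submodule.Quotient.mk_eq_zero _).1 hr
      exact h2
    ext μ
    exact (Submodule.Quotient.mk_eq_zero _).2 (h r h1 μ)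
  have : IsSimpleModule R (R ⧸ maximalIdeal R) :=
    isSimpleModule_iff_isCoatom.2 (maximalIdeal.isMaximal R).out
  have h1 : Module.length R (Sym (Fin s) N → R ⧸ maximalIdeal R) = s.multichoose N := by
    rw [Module.length_pi, ENat.card_eq_coe_fintype_card, Sym.card_sym_eq_multichoose,
      Fintype.card_fin, Module.length_eq_one, mul_one]
  rw [← h1, ← (ψ.quotKerEquivOfSurjective hψ).length_eq, lengthQuot,
    ← (F.quotKerEquivOfSurjective hF).length_eq]
  exact Module.length_le_of_surjective _ (Submodule.factor_surjective hker)

theorem sum_multichoose (n M : ℕ) :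
    ∑ i ∈ Finset.range (M + 1), n.multichoose i = (n + 1).multichoose M := by
  induction M with
  | zero => simp
  | succ M ih => rw [Finset.sum_range_succ, ih, Nat.multichoose_succ_succ, add_comm]

theorem multichoose_mono_left {n n' : ℕ} (h : n ≤ n') (k : ℕ) :
    n.multichoose k ≤ n'.multichoose k := by
  rw [← Fintype.card_fin n, ← Fintype.card_fin n', ← Sym.card_sym_eq_multichoose,
    ← Sym.card_sym_eq_multichoose]
  exact Fintype.card_le_of_injective _ (Sym.map_injective (Fin.castLE_injective h) k)

/-- The number of monomials grows faster in more variables. -/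
theorem exists_mul_multichoose_lt {d s : ℕ} (h : d < s) (C : ℕ) :
    ∃ M, C * (d + 1).multichoose M < (s + 1).multichoose M := by
  -- The ratio of the counts in `d + 2` and `d + 1` variables is `(d + 1 + M) / (d + 1)`, which
  -- equals `C + 1` for this `M`.
  refine ⟨(d + 1) * C, ?_⟩
  set M := (d + 1) * C with hM
  refine lt_of_lt_of_le ?_ (multichoose_mono_left (show d + 2 ≤ s + 1 by omega) M)
  have h1 : (d + 1) * (d + 2).multichoose M = (d + 1 + M) * (d + 1).multichoose M := by
    rw [Nat.multichoose_eq, Nat.multichoose_eq]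
    have e1 : d + 2 + M - 1 = (d + M) + 1 := by omega
    have e2 : d + 1 + M - 1 = d + M := by omega
    rw [e1, e2, Nat.choose_symm_of_eq_add (show d + M + 1 = M + (d + 1) by ring),
      Nat.choose_symm_of_eq_add (show d + M = M + d by ring), mul_comm,
      ← Nat.add_one_mul_choose_eq]
    ring
  have h2 : 0 < (d + 1).multichoose M := by
    rw [Nat.multichoose_eq]
    exact Nat.choose_pos (by omega)
  refine lt_of_mul_lt_mul_left ?_ (Nat.zero_le (d + 1))
  rw [h1, ← mul_assoc, ← hM]
  exact Nat.mul_lt_mul_of_pos_right (by omega) h2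

/-- An ideal of a Noetherian ring is generated by `spanFinrank` elements. -/
theorem exists_span_range_spanFinrank_eq {R : Type*} [CommRing R] [IsNoetherianRing R]
    (J : Ideal R) : ∃ a : Fin J.spanFinrank → R, Ideal.span (Set.range a) = J := by
  obtain ⟨S, hS, hSJ⟩ :=
    Submodule.FG.exists_span_finset_card_eq_spanFinrank (IsNoetherian.noetherian J)
  let e := S.equivFinOfCardEq hS
  refine ⟨fun i => (e.symm i : R), (congrArg (Submodule.span R) ?_).trans hSJ⟩
  ext x
  constructor
  · rintro ⟨i, rfl⟩
    exact (e.symm i).2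
  · intro hx
    exact ⟨e ⟨x, hx⟩, by simp⟩

/-- An ideal primary to the maximal ideal contains an ideal primary to the maximal ideal that is
generated by `dim R` elements. -/
theorem exists_span_range_le_isArtinianRing {R : Type*} [CommRing R] [IsLocalRing R]
    [IsNoetherianRing R] {H : Ideal R} (hH : H.radical = maximalIdeal R) {d : ℕ}
    (hd : ringKrullDim R = d) :
    ∃ q : Fin d → R, Ideal.span (Set.range q) ≤ H ∧
      IsArtinianRing (R ⧸ Ideal.span (Set.range q)) := by
  have hmin : H.minimalPrimes = {maximalIdeal R} := by
    rw [← Ideal.radical_minimalPrimes, hH, Ideal.minimalPrimes_eq_subsingleton_self]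
  have hheight : H.height = (maximalIdeal R).height := by
    rw [Ideal.height_eq_inf_minimalPrimes, hmin]
    simp
  have hmd : (maximalIdeal R).height = d := by
    have := maximalIdeal_height_eq_ringKrullDim (R := R)
    rw [hd] at this
    exact_mod_cast this
  have hHtop : H ≠ ⊤ := fun h => (maximalIdeal.isMaximal R).ne_top (by
    rw [← hH, h, Ideal.radical_top])
  -- The converse of the height theorem: `H`, of height `d`, contains an ideal of the same height
  -- generated by `d` elements.
  obtain ⟨J, hJ, hrank, hJh⟩ := Ideal.exists_spanRank_eq_and_height_eq H hHtop
  have hfin : J.spanFinrank = d := by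
    have h1 := Submodule.FG.spanRank_eq_spanFinrank (IsNoetherian.noetherian J)
    rw [hrank, hheight, hmd] at h1
    exact_mod_cast h1.symm
  obtain ⟨q, hq⟩ : ∃ q : Fin d → R, Ideal.span (Set.range q) = J :=
    hfin ▸ exists_span_range_spanFinrank_eq J
  refine ⟨q, ?_⟩
  rw [hq]
  refine ⟨hJ, quotient_artinian_of_mem_minimalPrimes_of_isLocalRing J ?_⟩
  refine Ideal.mem_minimalPrimes_of_height_le (hJ.trans ?_) ?_
  · rw [← hH]
    exact Ideal.le_radical
  · rw [hJh, hheight]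

theorem length_quotient_pow {R : Type*} [CommRing R] (J : Ideal R) (M : ℕ) :
    Module.length R (R ⧸ J ^ M) = ∑ i ∈ Finset.range M, lengthQuot (J ^ i) (J ^ (i + 1)) := by
  induction M with
  | zero =>
    rw [Finset.sum_range_zero, Module.length_eq_zero_iff, pow_zero, Ideal.one_eq_top]
    infer_instance
  | succ M ih =>
    rw [Finset.sum_range_succ, ← ih, length_quotient_eq_add (Ideal.pow_le_pow_right M.le_succ),
      add_comm]

/-! ### Minimal reductions are generated by `dim R` elements -/

/-- If an ideal primary to the maximal ideal is generated by more than `dim R` elements, then these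
generators satisfy a homogeneous relation modulo `𝔪 H ^ N` with a unit among its coefficients. -/
theorem exists_homogeneous_relation {R : Type*} [CommRing R] [IsLocalRing R]
    [IsNoetherianRing R] {s d : ℕ} (a : Fin s → R)
    (ha : (Ideal.span (Set.range a)).radical = maximalIdeal R) (hd : ringKrullDim R = d)
    (hs : d < s) : ∃ (N : ℕ) (r : Sym (Fin s) N → R),
      ∑ μ, r μ * symProd a μ ∈ maximalIdeal R * Ideal.span (Set.range a) ^ N ∧
        ∃ μ, IsUnit (r μ) := by
  by_contra! hcon
  -- Without such a relation, the length of `R / H ^ (M + 1)` is at least the number of monomials of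
  -- degree at most `M` in `s` variables. The inclusion `J ⊆ H` bounds it by `C` times the number in
  -- `d` variables, which grows too slowly.
  obtain ⟨q, hq, hart⟩ := exists_span_range_le_isArtinianRing ha hd
  set J := Ideal.span (Set.range q) with hJ
  set H := Ideal.span (Set.range a) with hH
  have hHm : H ≤ maximalIdeal R := by rw [← ha]; exact Ideal.le_radical
  have hfin : Module.length R (R ⧸ J) ≠ ⊤ := by
    rw [Module.length_eq_of_surjective (S := R) (R := R ⧸ J) Ideal.Quotient.mk_surjective]
    exact Module.length_ne_top
  obtain ⟨C, hC⟩ := ENat.ne_top_iff_exists.1 hfin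
  obtain ⟨M, hM⟩ := exists_mul_multichoose_lt hs C
  have h1 : ((s + 1).multichoose M : ℕ∞) ≤ Module.length R (R ⧸ H ^ (M + 1)) := by
    rw [length_quotient_pow, ← sum_multichoose, Nat.cast_sum]
    refine Finset.sum_le_sum fun i _ => multichoose_le_lengthQuot a i fun r hr μ => ?_
    refine hcon i r ?_ μ
    rw [← hH, pow_succ'] at hr
    exact Ideal.mul_mono_left hHm hr
  have h2 : Module.length R (R ⧸ H ^ (M + 1)) ≤ Module.length R (R ⧸ J ^ (M + 1)) :=
    Module.length_le_of_surjective _ (Submodule.factor_surjective (Ideal.pow_right_mono hq _))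
  have h3 : Module.length R (R ⧸ J ^ (M + 1)) ≤ ((d + 1).multichoose M : ℕ∞) * C := by
    rw [length_quotient_pow, ← sum_multichoose, Nat.cast_sum, Finset.sum_mul, hC]
    exact Finset.sum_le_sum fun i _ => lengthQuot_pow_succ_le q i
  have h4 := (h1.trans h2).trans h3
  rw [mul_comm] at h4
  exact absurd (by exact_mod_cast h4) (not_le.2 hM)

/-- A nonzero form over an infinite residue field does not vanish somewhere. -/
theorem exists_isUnit_sum_symProd {R : Type*} [CommRing R] [IsLocalRing R]
    [Infinite (ResidueField R)] {s N : ℕ} (r : Sym (Fin s) N → R) (hr : ∃ μ, IsUnit (r μ)) :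
    ∃ l : Fin s → R, IsUnit (∑ μ, r μ * symProd l μ) := by
  classical
  let f : MvPolynomial (Fin s) R := ∑ μ, MvPolynomial.C (r μ) * symProd MvPolynomial.X μ
  have hmon : ∀ m : Multiset (Fin s), (m.map (MvPolynomial.X (R := R))).prod =
      MvPolynomial.monomial (Multiset.toFinsupp m) 1 := by
    intro m
    induction m using Multiset.induction_on with
    | empty => simp
    | cons i m ih =>
      rw [Multiset.map_cons, Multiset.prod_cons, ih, MvPolynomial.X, MvPolynomial.monomial_mul,
        ← Multiset.singleton_add, map_add, Multiset.toFinsupp_singleton, one_mul]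
  obtain ⟨μ₀, hμ₀⟩ := hr
  have hcoeff : MvPolynomial.coeff (Multiset.toFinsupp (μ₀ : Multiset (Fin s))) f = r μ₀ := by
    simp only [f, symProd, hmon, MvPolynomial.coeff_sum, MvPolynomial.coeff_C_mul,
      MvPolynomial.coeff_monomial]
    rw [Finset.sum_eq_single μ₀]
    · simp
    · intro μ _ hμ
      rw [if_neg, mul_zero]
      intro h
      exact hμ (Sym.coe_injective (Multiset.toFinsupp.injective h))
    · simp
  have hf : MvPolynomial.map (residue R) f ≠ 0 := by
    intro h
    have := congrArg (MvPolynomial.coeff (Multiset.toFinsupp (μ₀ : Multiset (Fin s)))) h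
    rw [MvPolynomial.coeff_map, hcoeff, MvPolynomial.coeff_zero] at this
    exact (residue_ne_zero_iff_isUnit _).2 hμ₀ this
  obtain ⟨l, hl⟩ : ∃ l : Fin s → ResidueField R,
      MvPolynomial.eval l (MvPolynomial.map (residue R) f) ≠ 0 := by
    by_contra! h
    exact hf (MvPolynomial.funext fun x => by rw [h x, map_zero])
  choose l' hl' using fun i => residue_surjective (R := R) (l i)
  refine ⟨l', ?_⟩
  have h1 : MvPolynomial.eval l' f = ∑ μ, r μ * symProd l' μ := by
    simp [f, symProd, map_multiset_prod, Multiset.map_map]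
  rw [← h1, isUnit_eval_iff]
  simpa only [hl'] using hl

/-- If the ideal `H` is primary to the maximal ideal and generated by more than `dim R` elements,
then some reduction of `H` is generated by fewer elements. -/
theorem exists_isReduction_of_lt {R : Type*} [CommRing R] [IsLocalRing R]
    [IsNoetherianRing R] [Infinite (ResidueField R)] {s d : ℕ} (a : Fin s → R)
    (ha : (Ideal.span (Set.range a)).radical = maximalIdeal R) (hd : ringKrullDim R = d)
    (hs : d < s) : ∃ (j : Fin s) (y : {i // i ≠ j} → R),
      IsReduction (Ideal.span (Set.range y)) (Ideal.span (Set.range a)) := by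
  obtain ⟨N, r, hr, hunit⟩ := exists_homogeneous_relation a ha hd hs
  obtain ⟨l, hl⟩ := exists_isUnit_sum_symProd r hunit
  set H := Ideal.span (Set.range a) with hH
  -- In degree zero the relation would put a unit into `𝔪`.
  obtain _ | n := N
  · obtain ⟨μ, hμ⟩ := hunit
    exfalso
    rw [Fintype.sum_eq_single μ fun ν hν => (hν (Subsingleton.elim _ _)).elim] at hr
    rw [pow_zero, mul_one, Subsingleton.elim μ Sym.nil] at hr
    rw [Subsingleton.elim μ Sym.nil] at hμ
    exact (mem_maximalIdeal _).1 hr (by simpa [symProd] using hμ)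
  obtain ⟨j, hj⟩ : ∃ j, IsUnit (l j) := by
    by_contra! h
    refine (mem_maximalIdeal _).1 (Submodule.sum_mem (maximalIdeal R) fun μ _ => ?_) hl
    obtain ⟨i, μ, rfl⟩ := Sym.exists_eq_cons_of_succ μ
    rw [symProd_cons]
    exact Ideal.mul_mem_left _ _ (Ideal.mul_mem_right _ _ (h i))
  obtain ⟨v, hv⟩ := hj.exists_right_inv
  -- Normalized so that `l j * b = a j`. Modulo the ideal `L` of the `y i`, each `a i` becomes `l i
  -- * b`, the linear change of variables of Noether normalization.
  set b := v * a j with hb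
  let y : {i // i ≠ j} → R := fun i => a i - l i * b
  have haH : ∀ i, a i ∈ H := fun i => Ideal.subset_span ⟨i, rfl⟩
  have hbH : b ∈ H := Ideal.mul_mem_left _ _ (haH j)
  set L := Ideal.span (Set.range y) with hL
  have hyL : ∀ i, a i - l i * b ∈ L := by
    intro i
    by_cases hi : i = j
    · rw [hi, hb, ← mul_assoc, hv, one_mul, sub_self]
      exact L.zero_mem
    · exact Ideal.subset_span ⟨⟨i, hi⟩, rfl⟩
  have hLH : L ≤ H := by
    rw [hL, Ideal.span_le]
    rintro _ ⟨i, rfl⟩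
    exact sub_mem (haH i) (Ideal.mul_mem_left _ _ hbH)
  have hprodH : ∀ m : Multiset (Fin s), (m.map a).prod ∈ H ^ Multiset.card m := by
    intro m
    induction m using Multiset.induction_on with
    | empty => simp
    | cons i m ih =>
      rw [Multiset.map_cons, Multiset.prod_cons, Multiset.card_cons, pow_succ']
      exact Ideal.mul_mem_mul (haH i) ih
  -- In degree zero the difference vanishes, so the truncated exponent is harmless.
  have hdiff : ∀ m : Multiset (Fin s), (m.map a).prod - (m.map l).prod * b ^ Multiset.card m ∈
      L * H ^ (Multiset.card m - 1) := by
    intro m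
    induction m using Multiset.induction_on with
    | empty => simp
    | cons i m ih =>
      rw [Multiset.map_cons, Multiset.prod_cons, Multiset.map_cons, Multiset.prod_cons,
        Multiset.card_cons, Nat.add_sub_cancel]
      have h1 : a i * (m.map a).prod - l i * (m.map l).prod * b ^ (Multiset.card m + 1) =
          (a i - l i * b) * (m.map a).prod +
            l i * (b * ((m.map a).prod - (m.map l).prod * b ^ Multiset.card m)) := by ring
      rw [h1]
      refine add_mem (Ideal.mul_mem_mul (hyL i) (hprodH m)) (Ideal.mul_mem_left _ _ ?_)
      rcases Nat.eq_zero_or_pos (Multiset.card m) with h0 | h0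
      · rw [Multiset.card_eq_zero.1 h0]
        simp
      · have h2 : L * H ^ Multiset.card m = H * (L * H ^ (Multiset.card m - 1)) := by
          rw [mul_left_comm, ← pow_succ', Nat.sub_add_cancel h0]
        rw [h2]
        exact Ideal.mul_mem_mul hbH ih
  have hsum : ∑ μ, r μ * symProd a μ - (∑ μ, r μ * symProd l μ) * b ^ (n + 1) ∈ L * H ^ n := by
    rw [Finset.sum_mul, ← Finset.sum_sub_distrib]
    refine Submodule.sum_mem _ fun μ _ => ?_
    rw [mul_assoc, ← mul_sub]
    refine Ideal.mul_mem_left _ _ ?_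
    have := hdiff (μ : Multiset (Fin s))
    rwa [Sym.card_coe] at this
  -- After the substitution the relation reads `F(l) * b ^ (n + 1)` modulo `L * H ^ n`, and the
  -- value `F(l)` of the form at `l` is a unit.
  have hbpow : b ^ (n + 1) ∈ L * H ^ n ⊔ maximalIdeal R * H ^ (n + 1) := by
    rw [← Ideal.unit_mul_mem_iff_mem _ hl]
    have h1 := sub_mem (Submodule.mem_sup_right (S := L * H ^ n) hr) (Submodule.mem_sup_left hsum)
    simpa using h1
  have hHle : H ≤ L ⊔ Ideal.span {b} := by
    rw [hH, Ideal.span_le]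
    rintro _ ⟨i, rfl⟩
    have h1 := add_mem (Submodule.mem_sup_left (hyL i)) (Submodule.mem_sup_right (S := L)
      (Ideal.mul_mem_left _ (l i) (Ideal.mem_span_singleton_self b)))
    simpa using h1
  have hpow : ∀ k, H ^ (k + 1) ≤ L * H ^ k ⊔ Ideal.span {b ^ (k + 1)} := by
    intro k
    induction k with
    | zero => simpa using hHle
    | succ k ih =>
      rw [pow_succ]
      refine (Ideal.mul_mono_left ih).trans ?_
      rw [Ideal.sup_mul, mul_assoc, ← pow_succ]
      refine sup_le le_sup_left ?_
      refine (Ideal.mul_mono_right hHle).trans ?_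
      rw [Ideal.mul_sup, Ideal.span_singleton_mul_span_singleton, ← pow_succ, mul_comm]
      refine sup_le_sup_right (Ideal.mul_mono_right ?_) _
      rw [Ideal.span_singleton_le_iff_mem]
      exact Ideal.pow_mem_pow hbH _
  refine ⟨j, y, hLH, n, le_antisymm ?_ ?_⟩
  · refine Submodule.le_of_le_smul_of_le_jacobson_bot (I := maximalIdeal R)
      (IsNoetherian.noetherian _) (maximalIdeal_le_jacobson _) ?_
    refine (hpow n).trans (sup_le le_sup_left ?_)
    rw [Ideal.span_singleton_le_iff_mem]
    exact hbpow
  · rw [pow_succ']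
    exact Ideal.mul_mono_left hLH

/-- A minimal reduction of an ideal primary to the maximal ideal is generated by `dim R`
elements. -/
theorem IsMinimalReduction.exists_span_range_eq {R : Type*} [CommRing R] [IsLocalRing R]
    [IsNoetherianRing R] [Infinite (ResidueField R)] {H I : Ideal R}
    (hI : I.radical = maximalIdeal R) (hH : IsMinimalReduction H I) {d : ℕ}
    (hd : ringKrullDim R = d) : ∃ x : Fin d → R, Ideal.span (Set.range x) = H := by
  obtain ⟨a, ha⟩ := exists_span_range_spanFinrank_eq H
  have hle : H.spanFinrank ≤ d := by
    by_contra! hlt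
    obtain ⟨j, y, hy⟩ := exists_isReduction_of_lt a (by rw [ha, hH.prop.radical_eq, hI]) hd hlt
    rw [ha] at hy
    have h1 : H = Ideal.span (Set.range y) :=
      le_antisymm (hH.2 (hy.trans hH.prop) hy.1) hy.1
    have h2 : (Ideal.span (Set.range y)).spanFinrank ≤ (Set.range y).ncard :=
      Submodule.spanFinrank_span_le_ncard_of_finite (Set.finite_range y)
    rw [← h1] at h2
    have h3 : (Set.range y).ncard ≤ H.spanFinrank - 1 := by
      rw [← Nat.card_coe_set_eq]
      refine (Finite.card_range_le y).trans ?_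
      rw [Nat.card_eq_fintype_card, Fintype.card_subtype_compl, Fintype.card_fin,
        Fintype.card_subtype_eq]
    omega
  -- The generators are padded with zeros; only the upper bound on their number is needed.
  refine ⟨fun i => if h : (i : ℕ) < H.spanFinrank then a ⟨i, h⟩ else 0, le_antisymm ?_ ?_⟩
  · rw [Ideal.span_le]
    rintro _ ⟨i, rfl⟩
    dsimp only
    split_ifs with h
    · exact ha.le (Ideal.subset_span ⟨_, rfl⟩)
    · exact H.zero_mem
  · refine ha.ge.trans (Ideal.span_le.2 ?_)
    rintro _ ⟨i, rfl⟩
    exact Ideal.subset_span ⟨⟨i, i.2.trans_le hle⟩, by simp⟩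

/-! ### Parameters in Cohen-Macaulay local rings -/

open CategoryTheory Abelian RingTheory.Sequence in
/-- If `Ext N M` vanishes in degrees up to `n`, then `Ext N (M / x M)` vanishes in degrees below
`n` for each `M`-regular element `x`. -/
theorem subsingleton_ext_quotSMulTop.{u} {R : Type u} [CommRing R] (N M : ModuleCat.{u} R) {x : R}
    (hreg : IsSMulRegular M x) (n : ℕ) (h : ∀ i < n + 1, Subsingleton (Ext N M i)) (i : ℕ)
    (hi : i < n) : Subsingleton (Ext N (ModuleCat.of R (QuotSMulTop x M)) i) := by
  have zero1 := AddCommGrpCat.isZero_of_iff_subsingleton.mpr (h i (by omega))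
  have zero2 := AddCommGrpCat.isZero_of_iff_subsingleton.mpr (h (i + 1) (by omega))
  exact AddCommGrpCat.subsingleton_of_isZero <| ShortComplex.Exact.isZero_of_both_zeros
    ((Ext.covariant_sequence_exact₃' N hreg.smulShortComplex_shortExact) i (i + 1) rfl)
    (zero1.eq_zero_of_src _) (zero2.eq_zero_of_tgt _)

open RingTheory.Sequence in
/-- Dividing by one regular element lowers the length of a regular sequence by at most one. -/
theorem exists_isRegular_quotSMulTop.{u} {R M : Type u} [CommRing R] [IsLocalRing R]
    [IsNoetherianRing R] [AddCommGroup M] [Module R M] [Module.Finite R M] [Nontrivial M]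
    (rs : List R) (hmem : ∀ r ∈ rs, r ∈ maximalIdeal R) (hrs : IsRegular M rs) {n : ℕ}
    (hn : rs.length = n + 1) {x : R} (hx : x ∈ maximalIdeal R) (hreg : IsSMulRegular M x) :
    ∃ rs' : List R, rs'.length = n ∧ (∀ r ∈ rs', r ∈ maximalIdeal R) ∧
      IsRegular (QuotSMulTop x M) rs' := by
  have hlt : ∀ (L : Type u) [AddCommGroup L] [Module R L] [Module.Finite R L] [Nontrivial L],
      maximalIdeal R • (⊤ : Submodule R L) < ⊤ := fun L _ _ _ _ =>
    (Submodule.top_ne_ideal_smul_of_le_jacobson_annihilator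
      (maximalIdeal_le_jacobson _)).symm.lt_top
  have hN : Module.support R (R ⧸ maximalIdeal R) =
      PrimeSpectrum.zeroLocus (maximalIdeal R) := by
    rw [Module.support_eq_zeroLocus, Ideal.annihilator_quotient]
  -- Rees's criterion: regular sequences of length `n + 1` in `𝔪` exist on `M` exactly when `Ext`
  -- from the residue field vanishes in degrees at most `n`. The vanishing passes to `M / x M` with
  -- a loss of one degree.
  have hext := ModuleCat.subsingleton_ext_of_exists_isRegular (maximalIdeal R)
    (ModuleCat.of R (R ⧸ maximalIdeal R)) hN.le (ModuleCat.of R M) (hlt M) rs hmem hrs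
  have := nontrivial_quotSMulTop_of_mem_maximalIdeal M hx
  refine ModuleCat.exists_isRegular_of_exists_subsingleton_ext (maximalIdeal R) n
    (ModuleCat.of R (QuotSMulTop x M)) (hlt _) (ModuleCat.of R (R ⧸ maximalIdeal R)) hN
    (subsingleton_ext_quotSMulTop _ (ModuleCat.of R M) hreg n fun i hi => hext i (by omega))

open RingTheory.Sequence Pointwise in
/-- The length of a regular sequence on `M` is at most `dim (R / p)` for each associated prime
`p` of `M`. -/
theorem length_le_ringKrullDim_quotient_of_isAssociatedPrime {R M : Type*} [CommRing R]
    [IsLocalRing R] [IsNoetherianRing R] [AddCommGroup M] [Module R M] [Module.Finite R M]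
    (rs : List R) (hmem : ∀ r ∈ rs, r ∈ maximalIdeal R) (hrs : IsRegular M rs) {p : Ideal R}
    (hp : IsAssociatedPrime p M) : (rs.length : WithBot ℕ∞) ≤ ringKrullDim (R ⧸ p) := by
  induction rs generalizing M p with
  | nil =>
    have := hp.isPrime
    simpa using ringKrullDim_nonneg_of_nontrivial
  | cons y rs ih =>
    rw [isRegular_cons_iff] at hrs
    have hy : y ∈ maximalIdeal R := hmem y List.mem_cons_self
    have hprime := hp.isPrime
    obtain ⟨-, u, hu⟩ := isAssociatedPrime_iff.1 hp
    have hmemp : ∀ t, t ∈ p ↔ t • u = 0 := fun t => by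
      rw [hu, Submodule.mem_colon_singleton, Submodule.mem_bot]
    have hu0 : u ≠ 0 := fun h => hprime.ne_top ((Ideal.eq_top_iff_one p).2 (by simp [hmemp, h]))
    have hyp : y ∉ p := fun h => hu0 (hrs.1 (by
      change y • u = y • (0 : M)
      rw [smul_zero]
      exact (hmemp y).1 h))
    -- If the elements killed by `p` all lay in `y M`, regularity of `y` would make their submodule
    -- `N` satisfy `N = y N`, so `N = 0` by Nakayama, although `u` lies in `N`.
    obtain ⟨v, hv, hvy⟩ : ∃ v : M, (∀ t ∈ p, t • v = 0) ∧ v ∉ y • (⊤ : Submodule R M) := by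
      by_contra! hcon
      let N : Submodule R M := Submodule.torsionBySet R M p
      have hN : ∀ v, v ∈ N ↔ ∀ t ∈ p, t • v = 0 := fun v => by
        simp [N, Submodule.mem_torsionBySet_iff]
      have hle : N ≤ ⊥ := by
        refine Submodule.le_of_le_smul_of_le_jacobson_bot (I := maximalIdeal R)
          (IsNoetherian.noetherian _) (maximalIdeal_le_jacobson _) ?_
        rw [bot_sup_eq]
        intro v hv
        obtain ⟨w, -, rfl⟩ := Submodule.mem_smul_pointwise_iff_exists _ _ _ |>.1
          (hcon v ((hN v).1 hv))
        refine Submodule.smul_mem_smul hy ((hN w).2 fun t ht => hrs.1 ?_)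
        change y • t • w = y • (0 : M)
        rw [smul_zero, smul_comm]
        exact (hN _).1 hv t ht
      have : u ∈ (⊥ : Submodule R M) := hle ((hN u).2 fun t ht => (hmemp t).1 ht)
      exact hu0 ((Submodule.mem_bot R).1 this)
    -- The class of `v` modulo `y` is killed by `p` and `y`. An associated prime `q` above its
    -- annihilator strictly contains `p`, so the dimension drops by at least one.
    obtain ⟨q, hq, hqv⟩ := exists_le_isAssociatedPrime_of_isNoetherianRing R
      (Submodule.Quotient.mk v : QuotSMulTop y M) fun h =>
        hvy ((Submodule.Quotient.mk_eq_zero _).1 h)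
    have hpq : p ≤ q := fun t ht => hqv (by
      rw [Submodule.mem_colon_singleton, Submodule.mem_bot, ← Submodule.Quotient.mk_smul, hv t ht,
        Submodule.Quotient.mk_zero])
    have hyq : y ∈ q := hqv (by
      rw [Submodule.mem_colon_singleton, Submodule.mem_bot, ← Submodule.Quotient.mk_smul,
        Submodule.Quotient.mk_eq_zero]
      exact Submodule.smul_mem_pointwise_smul _ _ _ trivial)
    have h1 := ih (fun r hr => hmem r (List.mem_cons_of_mem _ hr)) hrs.2 hq
    have h2 : ringKrullDim (R ⧸ q) + 1 ≤ ringKrullDim (R ⧸ p) := by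
      have hne : Ideal.Quotient.mk p y ≠ 0 := by rwa [Ne, Ideal.Quotient.eq_zero_iff_mem]
      refine le_trans ?_ (ringKrullDim_quotient_succ_le_of_nonZeroDivisor
        (mem_nonZeroDivisors_of_ne_zero hne))
      gcongr
      let f : (R ⧸ p) ⧸ Ideal.span {Ideal.Quotient.mk p y} →+* R ⧸ q :=
        Ideal.Quotient.lift _ (Ideal.Quotient.factor hpq) fun a ha => by
          obtain ⟨c, rfl⟩ := Ideal.mem_span_singleton'.1 ha
          rw [map_mul, Ideal.Quotient.factor_mk, Ideal.Quotient.eq_zero_iff_mem.2 hyq, mul_zero]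
      refine ringKrullDim_le_of_surjective f ?_
      exact Ideal.Quotient.lift_surjective_of_surjective _ _ (Ideal.Quotient.factor_surjective hpq)
    rw [List.length_cons, Nat.cast_add, Nat.cast_one]
    exact (add_le_add_left h1 1).trans h2

open RingTheory.Sequence Pointwise in
/-- A system of parameters of a Cohen-Macaulay module is a regular sequence. -/
theorem isWeaklyRegular_of_systemOfParameters.{u} {R M : Type u} [CommRing R]
    [IsLocalRing R] [IsNoetherianRing R] [AddCommGroup M] [Module R M] [Module.Finite R M]
    [Nontrivial M] (rs : List R) (hmem : ∀ r ∈ rs, r ∈ maximalIdeal R) (hrs : IsRegular M rs)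
    (xs : List R) (hxs : ∀ x ∈ xs, x ∈ maximalIdeal R) (hlen : rs.length = xs.length)
    (hparam : ∀ q : Ideal R, q.IsPrime → Module.annihilator R M ≤ q → (∀ x ∈ xs, x ∈ q) →
      q = maximalIdeal R) : IsWeaklyRegular M xs := by
  induction xs generalizing M rs with
  | nil => exact IsWeaklyRegular.nil R M
  | cons x xs ih =>
    have hx : x ∈ maximalIdeal R := hxs x List.mem_cons_self
    have hreg : IsSMulRegular M x := by
      -- A zero divisor `x` lies in an associated prime `p`. The remaining parameters then define
      -- the maximal ideal of `R / p` up to radical, so `dim (R / p)` is below the length of `rs`,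
      -- against the preceding bound.
      by_contra hcon
      have h1 : x ∈ ⋃ p ∈ associatedPrimes R M, (p : Set R) := by
        rw [biUnion_associatedPrimes_eq_compl_regular]
        exact hcon
      simp only [Set.mem_iUnion, SetLike.mem_coe] at h1
      obtain ⟨p, hp, hxp⟩ := h1
      have hprime : p.IsPrime := hp.isPrime
      have hann : Module.annihilator R M ≤ p := by
        obtain ⟨-, u, hu⟩ := isAssociatedPrime_iff.1 hp
        intro t ht
        rw [hu, Submodule.mem_colon_singleton, Submodule.mem_bot]
        exact Module.mem_annihilator.1 ht u
      have h2 := length_le_ringKrullDim_quotient_of_isAssociatedPrime rs hmem hrs hp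
      have hloc : IsLocalRing (R ⧸ p) :=
        IsLocalRing.of_surjective' (Ideal.Quotient.mk p) Ideal.Quotient.mk_surjective
      have hhom : IsLocalHom (Ideal.Quotient.mk p) :=
        Ideal.Quotient.mk_surjective.isLocalHom
      let z : Fin xs.length → R ⧸ p := fun i => Ideal.Quotient.mk p (xs.get i)
      have h3 := ringKrullDim_le_of_radical_span_eq z (by
        rw [Ideal.radical_eq_sInf]
        apply le_antisymm
        · refine sInf_le ⟨?_, inferInstance⟩
          rw [Ideal.span_le]
          rintro _ ⟨i, rfl⟩
          refine (mem_maximalIdeal _).2 fun hu => ?_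
          have h4 := hxs (xs.get i) (List.mem_cons_of_mem _ (List.get_mem _ _))
          exact (mem_maximalIdeal _).1 h4 (isUnit_of_map_unit (Ideal.Quotient.mk p) _ hu)
        · refine le_sInf ?_
          rintro Q ⟨hQ, hQp⟩
          have h5 := hparam (Q.comap (Ideal.Quotient.mk p)) (Ideal.comap_isPrime _ _)
            (hann.trans fun t ht => by
              rw [Ideal.mem_comap, Ideal.Quotient.eq_zero_iff_mem.2 ht]
              exact Q.zero_mem) (by
            rintro y hy
            rw [Ideal.mem_comap]
            rcases List.mem_cons.1 hy with rfl | hy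
            · rw [Ideal.Quotient.eq_zero_iff_mem.2 hxp]
              exact Q.zero_mem
            · obtain ⟨i, rfl⟩ := List.get_of_mem hy
              exact hQ (Ideal.subset_span ⟨i, rfl⟩))
          intro t ht
          obtain ⟨t, rfl⟩ := Ideal.Quotient.mk_surjective t
          refine (h5.ge : _) ((mem_maximalIdeal t).2 fun hu => ?_)
          exact (mem_maximalIdeal _).1 ht (hu.map _))
      rw [Fintype.card_fin] at h3
      have h4 := h2.trans h3
      rw [hlen, List.length_cons] at h4
      have h5 : xs.length + 1 ≤ xs.length := by exact_mod_cast h4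
      omega
    obtain ⟨rs', hlen', hmem', hrs'⟩ := exists_isRegular_quotSMulTop rs hmem hrs
      (n := xs.length) hlen hx hreg
    have := nontrivial_quotSMulTop_of_mem_maximalIdeal M hx
    refine IsWeaklyRegular.cons hreg (ih rs' hmem' hrs'
      (fun y hy => hxs y (List.mem_cons_of_mem _ hy)) hlen' fun q hq hann hxq => ?_)
    refine hparam q hq (fun t ht => hann ?_) fun y hy => ?_
    · refine Module.mem_annihilator.2 fun m => ?_
      obtain ⟨m, rfl⟩ := Submodule.Quotient.mk_surjective _ m
      rw [← Submodule.Quotient.mk_smul, Module.mem_annihilator.1 ht, Submodule.Quotient.mk_zero]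
    · rcases List.mem_cons.1 hy with rfl | hy
      · refine hann (Module.mem_annihilator.2 fun m => ?_)
        obtain ⟨m, rfl⟩ := Submodule.Quotient.mk_surjective _ m
        rw [← Submodule.Quotient.mk_smul, Submodule.Quotient.mk_eq_zero]
        exact Submodule.smul_mem_pointwise_smul _ _ _ trivial
      · exact hxq y hy

/-- In a Cohen-Macaulay local ring, each element of a system of parameters is regular modulo the
preceding ones. -/
theorem IsCohenMacaulayLocal.mem_span_of_mul_mem {R : Type*} [CommRing R] [IsLocalRing R]
    [IsNoetherianRing R] (hR : IsCohenMacaulayLocal R) {n : ℕ} (hd : ringKrullDim R = n)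
    (x : Fin n → R) (hx : (Ideal.span (Set.range x)).radical = maximalIdeal R) (i : Fin n) (y : R)
    (hy : y * x i ∈ Ideal.span (x '' Set.Iio i)) : y ∈ Ideal.span (x '' Set.Iio i) := by
  obtain ⟨rs, hmem, hrs, hlen⟩ := hR
  have hlen' : rs.length = n := by
    rw [hd] at hlen
    exact_mod_cast hlen.symm
  have hxm : ∀ i, x i ∈ maximalIdeal R := fun i => by
    rw [← hx]
    exact Ideal.le_radical (Ideal.subset_span ⟨i, rfl⟩)
  have hreg := isWeaklyRegular_of_systemOfParameters rs hmem hrs (List.ofFn x)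
    (fun y hy => by
      obtain ⟨i, rfl⟩ := (List.mem_ofFn' _ _).1 hy
      exact hxm i)
    (by rw [List.length_ofFn, hlen'])
    (fun q hq _ hxq => by
      refine le_antisymm (le_maximalIdeal hq.ne_top) ?_
      rw [← hx, hq.radical_le_iff, Ideal.span_le]
      rintro _ ⟨i, rfl⟩
      exact hxq _ ((List.mem_ofFn' _ _).2 ⟨i, rfl⟩))
  have hi := hreg.regular_mod_prev i (by rw [List.length_ofFn]; exact i.2)
  have hspan : (Ideal.ofList ((List.ofFn x).take i) • ⊤ : Ideal R) =
      Ideal.span (x '' Set.Iio i) := by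
    rw [smul_eq_mul, Ideal.mul_top, Ideal.ofList]
    congr 1
    ext z
    simp only [Set.mem_ofPred_eq, List.mem_take_iff_getElem, Set.mem_image, Set.mem_Iio]
    constructor
    · rintro ⟨j, hj, rfl⟩
      rw [List.length_ofFn, lt_min_iff] at hj
      exact ⟨⟨j, hj.2⟩, hj.1, by simp⟩
    · rintro ⟨j, hj, rfl⟩
      exact ⟨j, by rw [List.length_ofFn, lt_min_iff]; exact ⟨hj, j.2⟩, by simp⟩
  rw [hspan, List.getElem_ofFn] at hi
  rw [← Ideal.Quotient.eq_zero_iff_mem]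
  refine hi ?_
  change x i • Ideal.Quotient.mk _ y = x i • (0 : R ⧸ Ideal.span (x '' Set.Iio i))
  rw [smul_zero, Algebra.smul_def, Ideal.Quotient.algebraMap_eq, ← map_mul,
    Ideal.Quotient.eq_zero_iff_mem, mul_comm]
  exact hy

/-! ### Relations among general elements modulo `I ^ 2` -/

/-- The elements of a finite sequence before the last one. -/
theorem image_Iio_last {α : Type*} {n : ℕ} (x : Fin (n + 1) → α) :
    x '' Set.Iio (Fin.last n) = Set.range fun i : Fin n => x i.castSucc := by
  ext z
  constructor
  · rintro ⟨j, hj, rfl⟩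
    exact ⟨j.castLT hj, rfl⟩
  · rintro ⟨j, rfl⟩
    exact ⟨_, j.castSucc_lt_last, rfl⟩

/-- The syzygies of a regular sequence have coefficients in the ideal that it generates. -/
theorem mem_span_of_sum_mul_eq_zero {R : Type*} [CommRing R] {n : ℕ} (x : Fin n → R)
    (hx : ∀ i y, y * x i ∈ Ideal.span (x '' Set.Iio i) → y ∈ Ideal.span (x '' Set.Iio i))
    (r : Fin n → R) (hr : ∑ i, r i * x i = 0) (i : Fin n) : r i ∈ Ideal.span (Set.range x) := by
  induction n with
  | zero => exact i.elim0
  | succ n ih =>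
    have hle : Ideal.span (Set.range fun i : Fin n => x i.castSucc) ≤ Ideal.span (Set.range x) :=
      Ideal.span_mono (by rintro _ ⟨j, rfl⟩; exact ⟨_, rfl⟩)
    rw [Fin.sum_univ_castSucc] at hr
    have hlast : r (Fin.last n) ∈ Ideal.span (Set.range fun i : Fin n => x i.castSucc) := by
      rw [← image_Iio_last]
      refine hx _ _ ?_
      rw [image_Iio_last, ← neg_eq_of_add_eq_zero_right hr]
      exact neg_mem (Submodule.sum_mem _ fun j _ => Ideal.mul_mem_left _ _
        (Ideal.subset_span ⟨j, rfl⟩))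
    obtain ⟨b, hb⟩ := Ideal.mem_span_range_iff_exists_fun.1 hlast
    -- Substituting `r (Fin.last n) = ∑ b i * x i` absorbs the last term into the others and leaves
    -- a syzygy of the shorter sequence.
    have key := ih (fun i => x i.castSucc) (fun i y hy => by
      have h1 : (fun i : Fin n => x i.castSucc) '' Set.Iio i = x '' Set.Iio i.castSucc := by
        rw [← Fin.image_castSucc_Iio, Set.image_image]
      rw [h1] at hy ⊢
      exact hx _ y hy) (fun i => r i.castSucc + b i * x (Fin.last n)) (by
        rw [← hr, ← hb, Finset.sum_mul, ← Finset.sum_add_distrib]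
        exact Finset.sum_congr rfl fun j _ => by ring)
    refine Fin.lastCases (hle hlast) (fun j => ?_) i
    have h1 := sub_mem (hle (key j)) (Ideal.mul_mem_left (Ideal.span (Set.range x)) (b j)
      (Ideal.subset_span ⟨Fin.last n, rfl⟩))
    simpa using h1

theorem sum_linearCombos_mul {R : Type*} [CommRing R] {s t p : ℕ} (a : Fin s → R)
    (v : Fin p → R) (ρ : Fin t × Fin p → R) (c : Fin t × Fin s → R) :
    ∑ i, (∑ b, ρ (i, b) * v b) * linearCombos a c i =
      ∑ q : Fin s × Fin p, (∑ i, ρ (i, q.2) * c (i, q.1)) * (v q.2 * a q.1) := by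
  simp only [linearCombos, Fintype.sum_prod_type, Finset.sum_mul, Finset.mul_sum]
  rw [Finset.sum_comm]
  refine Finset.sum_congr rfl fun j _ => ?_
  rw [Finset.sum_comm]
  exact Finset.sum_congr rfl fun b _ => Finset.sum_congr rfl fun i _ => by ring

/-- The residues of the coefficient vectors in a submodule. -/
def residueSubmodule {R ι : Type*} [CommRing R] [IsLocalRing R] (K : Submodule R (ι → R)) :
    Submodule (ResidueField R) (ι → ResidueField R) where
  carrier := {v | ∃ y ∈ K, ∀ q, residue R (y q) = v q}
  zero_mem' := ⟨0, K.zero_mem, fun q => by simp⟩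
  add_mem' := by
    rintro v w ⟨y, hy, hyv⟩ ⟨z, hz, hzw⟩
    exact ⟨y + z, K.add_mem hy hz, fun q => by simp [hyv, hzw]⟩
  smul_mem' := by
    rintro r v ⟨y, hy, hyv⟩
    obtain ⟨r, rfl⟩ := residue_surjective r
    exact ⟨r • y, K.smul_mem r hy, fun q => by simp [hyv]⟩

/-- If, for some elements `x` of `I`, the relation `∑ r i * x i ∈ I ^ 2` forces all `r i` to lie in
`I`, then so it does for general elements `x`. -/
theorem coefficients_mem_of_general {R : Type*} [CommRing R] [IsLocalRing R] [IsNoetherianRing R]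
    {I : Ideal R} (hI : I.radical = maximalIdeal R) {s t : ℕ} (a : Fin s → R)
    (ha : Ideal.span (Set.range a) = I) (c₀ : Fin t × Fin s → R)
    (h : ∀ r : Fin t → R, ∑ i, r i * linearCombos a c₀ i ∈ I ^ 2 → ∀ i, r i ∈ I) :
    ∃ f : MvPolynomial (Fin t × Fin s) (ResidueField R), f ≠ 0 ∧
      ∀ c : Fin t × Fin s → R, MvPolynomial.eval (fun p => residue R (c p)) f ≠ 0 →
        ∀ r : Fin t → R, ∑ i, r i * linearCombos a c i ∈ I ^ 2 → ∀ i, r i ∈ I := by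
  classical
  have haI : ∀ j, a j ∈ I := fun j => ha ▸ Ideal.subset_span ⟨j, rfl⟩
  have hxI : ∀ c (i : Fin t), linearCombos a c i ∈ I := fun c i =>
    Submodule.sum_mem _ fun j _ => Ideal.mul_mem_left _ _ (haI j)
  -- The ideal `T = I : 𝔪`, whose quotient by `I` is the socle of `R / I`; the `v b` below lift a
  -- basis of it.
  let T : Ideal R :=
    { carrier := {r | ∀ m ∈ maximalIdeal R, m * r ∈ I}
      zero_mem' := fun m _ => by simp
      add_mem' := fun {x y} hx hy m hm => by
        rw [mul_add]
        exact I.add_mem (hx m hm) (hy m hm)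
      smul_mem' := fun r x hx m hm => by
        rw [smul_eq_mul, mul_left_comm]
        exact I.mul_mem_left r (hx m hm) }
  obtain ⟨p, w, hw, hwmin⟩ := exists_minimal_generators R (T ⧸ Submodule.comap T.subtype I)
  choose v hv using fun b => Submodule.Quotient.mk_surjective _ (w b)
  have hvT : ∀ b, ∀ m ∈ maximalIdeal R, m * (v b : R) ∈ I := fun b => (v b).2
  have hrel : ∀ y : Fin p → R, ∑ b, y b * (v b : R) ∈ I → ∀ b, y b ∈ maximalIdeal R := by
    intro y hy
    refine hwmin y ?_
    simp only [← hv, ← Submodule.Quotient.mk_smul]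
    simp only [← Submodule.mkQ_apply]
    rw [← map_sum, Submodule.mkQ_apply, Submodule.Quotient.mk_eq_zero, Submodule.mem_comap]
    simpa using hy
  have hgen : ∀ r : R, (∀ m ∈ maximalIdeal R, m * r ∈ I) →
      ∃ ρ : Fin p → R, r - ∑ b, ρ b * (v b : R) ∈ I := by
    intro r hr
    have h1 : (Submodule.Quotient.mk (⟨r, hr⟩ : T) : T ⧸ Submodule.comap T.subtype I) ∈
      Submodule.span R (Set.range w) := hw ▸ Submodule.mem_top
    obtain ⟨ρ, hρ⟩ := (Submodule.mem_span_range_iff_exists_fun R).1 h1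
    refine ⟨ρ, ?_⟩
    simp only [← hv, ← Submodule.Quotient.mk_smul] at hρ
    simp only [← Submodule.mkQ_apply] at hρ
    rw [← map_sum, eq_comm, Submodule.mkQ_apply, Submodule.mkQ_apply, Submodule.Quotient.eq,
      Submodule.mem_comap] at hρ
    simpa using hρ
  let K : Submodule R (Fin s × Fin p → R) := Submodule.comap
    (Fintype.linearCombination R fun q => (v q.2 : R) * a q.1) (I ^ 2)
  have hK : ∀ y, y ∈ K ↔ ∑ q, y q * ((v q.2 : R) * a q.1) ∈ I ^ 2 := fun y => by
    simp [K, Fintype.linearCombination_apply]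
  -- Membership in `K` depends only on residues, because `𝔪 * v b ⊆ I` and `a j ∈ I`. The problem on
  -- the socle is thus linear algebra over the residue field.
  have hKres : ∀ y : Fin s × Fin p → R,
      (fun q => residue R (y q)) ∈ residueSubmodule K → y ∈ K := by
    rintro y ⟨z, hz, hzy⟩
    rw [← sub_add_cancel y z]
    refine K.add_mem ((hK _).2 (Submodule.sum_mem _ fun q _ => ?_)) hz
    rw [← mul_assoc, sq]
    refine Ideal.mul_mem_mul (hvT _ _ ?_) (haI _)
    rw [← residue_eq_zero_iff, Pi.sub_apply, map_sub, hzy, sub_self]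
  let φ : (Fin t × Fin s → ResidueField R) → (Fin t × Fin p → ResidueField R) →ₗ[ResidueField R]
      (Fin s × Fin p → ResidueField R) := fun c =>
    LinearMap.pi fun q => ∑ i, c (i, q.1) • LinearMap.proj (i, q.2)
  have hφ : ∀ c ρ q, φ c ρ q = ∑ i, ρ (i, q.2) * c (i, q.1) := fun c ρ q => by
    simp [φ, mul_comm]
  have hφres : ∀ (c : Fin t × Fin s → R) (ρ : Fin t × Fin p → R),
      φ (fun q => residue R (c q)) (fun q => residue R (ρ q)) =
        fun q => residue R (∑ i, ρ (i, q.2) * c (i, q.1)) := fun c ρ => by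
    ext q
    simp only [map_sum, map_mul]
    exact hφ (fun q => residue R (c q)) (fun q => residue R (ρ q)) q
  let c₀' : Fin t × Fin s → ResidueField R := fun q => residue R (c₀ q)
  have hker : LinearMap.ker ((residueSubmodule K).mkQ.comp (φ c₀')) = ⊥ := by
    rw [LinearMap.ker_eq_bot']
    intro ρ hρ
    choose ρ' hρ' using fun q => residue_surjective (R := R) (ρ q)
    obtain rfl : (fun q => residue R (ρ' q)) = ρ := funext hρ'
    have h1 : φ c₀' (fun q => residue R (ρ' q)) ∈ residueSubmodule K :=
      (Submodule.Quotient.mk_eq_zero _).1 hρ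
    rw [hφres] at h1
    have h2 := (hK _).1 (hKres _ h1)
    rw [← sum_linearCombos_mul a (fun b => (v b : R)) ρ' c₀] at h2
    ext ⟨i, b⟩
    exact (residue_eq_zero_iff _).2 (hrel _ (h _ h2 i) b)
  -- A left inverse at `c₀`, kept fixed while `c` varies. The determinant of its composite with the
  -- map at `c` is polynomial in `c` and equals one at `c₀`.
  obtain ⟨g, hg⟩ := LinearMap.exists_leftInverse_of_injective _ hker
  let P := g.comp (residueSubmodule K).mkQ
  have hPφ : ∀ ρ, P (φ c₀' ρ) = ρ := fun ρ => LinearMap.congr_fun hg ρ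
  have hPK : ∀ y ∈ residueSubmodule K, P y = 0 := fun y hy => by
    simp [P, (Submodule.Quotient.mk_eq_zero _).2 hy]
  let M : Matrix (Fin t × Fin p) (Fin t × Fin p) (MvPolynomial (Fin t × Fin s) (ResidueField R)) :=
    Matrix.of fun q q' => ∑ j, MvPolynomial.C (P (Pi.single (j, q.2) 1) q') *
      MvPolynomial.X (q.1, j)
  have hM : ∀ c, M.map (MvPolynomial.eval c) = (LinearMap.toMatrix' (P.comp (φ c))).transpose := by
    intro c
    ext q q'
    have h1 : φ c (Pi.single q 1) = ∑ j, c (q.1, j) • Pi.single (j, q.2) 1 := by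
      ext ⟨j, b⟩
      rw [hφ]
      obtain ⟨i, b'⟩ := q
      by_cases hb : b = b' <;>
        simp [Finset.sum_apply, Pi.single_apply, hb]
    rw [Matrix.transpose_apply, LinearMap.toMatrix'_apply]
    simp only [M, Matrix.map_apply, Matrix.of_apply, map_sum, map_mul, MvPolynomial.eval_C,
      MvPolynomial.eval_X]
    rw [LinearMap.comp_apply, h1, map_sum, Finset.sum_apply]
    exact Finset.sum_congr rfl fun j _ => by rw [map_smul, Pi.smul_apply, smul_eq_mul, mul_comm]
  refine ⟨M.det, fun h0 => ?_, fun c hc r hr => ?_⟩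
  · have h1 : MvPolynomial.eval c₀' M.det = 1 := by
      rw [det_eval, hM, Matrix.det_transpose,
        show P.comp (φ c₀') = LinearMap.id from LinearMap.ext hPφ, LinearMap.toMatrix'_id,
        Matrix.det_one]
    simp [h0] at h1
  · by_contra! hcon
    obtain ⟨n, hn⟩ : ∃ n, ∀ τ ∈ maximalIdeal R ^ n, ∀ i, τ * r i ∈ I := by
      obtain ⟨n, hn⟩ := Ideal.exists_radical_pow_le_of_fg I (IsNoetherian.noetherian _)
      rw [hI] at hn
      exact ⟨n, fun τ hτ i => I.mul_mem_right _ (hn hτ)⟩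
    -- A counterexample is moved into the socle: a power of `𝔪` lies in `I`, so some multiplier `τ`
    -- makes every `τ * r i` socle modulo `I` while keeping one of them nonzero there.
    obtain ⟨τ, hτ, i₀, hi₀⟩ : ∃ τ, (∀ i, ∀ m ∈ maximalIdeal R, m * (τ * r i) ∈ I) ∧
        ∃ i, τ * r i ∉ I := by
      induction n with
      | zero =>
        obtain ⟨i, hi⟩ := hcon
        refine absurd ?_ hi
        simpa using hn 1 (by simp) i
      | succ n ih =>
        by_cases hn' : ∀ τ ∈ maximalIdeal R ^ n, ∀ i, τ * r i ∈ I
        · exact ih hn'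
        · push Not at hn'
          obtain ⟨τ, hτ, i, hi⟩ := hn'
          refine ⟨τ, fun i m hm => ?_, i, hi⟩
          rw [← mul_assoc]
          refine hn _ ?_ i
          rw [pow_succ']
          exact Ideal.mul_mem_mul hm hτ
    choose ρ hρ using fun i => hgen _ (hτ i)
    let ρ' : Fin t × Fin p → R := fun q => ρ q.1 q.2
    have h1 : ∑ i, (∑ b, ρ' (i, b) * (v b : R)) * linearCombos a c i ∈ I ^ 2 := by
      have h2 : ∑ i, (∑ b, ρ' (i, b) * (v b : R)) * linearCombos a c i =
          τ * ∑ i, r i * linearCombos a c i -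
            ∑ i, (τ * r i - ∑ b, ρ i b * (v b : R)) * linearCombos a c i := by
        rw [Finset.mul_sum, ← Finset.sum_sub_distrib]
        exact Finset.sum_congr rfl fun i _ => by ring
      rw [h2]
      refine sub_mem (Ideal.mul_mem_left _ _ hr) (Submodule.sum_mem _ fun i _ => ?_)
      rw [sq]
      exact Ideal.mul_mem_mul (hρ i) (hxI c i)
    rw [sum_linearCombos_mul a (fun b => (v b : R)) ρ' c] at h1
    have h2 := (hK _).2 h1
    have h3 : (P.comp (φ fun q => residue R (c q))) (fun q => residue R (ρ' q)) = 0 := by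
      rw [LinearMap.comp_apply, hφres]
      exact hPK _ ⟨_, h2, fun q => rfl⟩
    rw [det_eval, hM, Matrix.det_transpose] at hc
    rw [← LinearMap.toMatrix'_mulVec] at h3
    have h4 := Matrix.eq_zero_of_mulVec_eq_zero hc h3
    have h5 : ∑ b, ρ i₀ b * (v b : R) ∈ I := Submodule.sum_mem _ fun b _ =>
      hvT b _ ((residue_eq_zero_iff _).1 (congrFun h4 (i₀, b)))
    have h6 := add_mem (hρ i₀) h5
    rw [sub_add_cancel] at h6
    exact hi₀ h6

/-! ### General elements and the two implications -/

theorem isZariskiDenseOpen_ne_zero {σ k : Type*} [Field k] [Infinite k] {f : MvPolynomial σ k}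
    (hf : f ≠ 0) : IsZariskiDenseOpen {x : σ → k | MvPolynomial.eval x f ≠ 0} := by
  refine ⟨⟨{f}, by simp⟩, ?_⟩
  rintro V ⟨T, rfl⟩ ⟨y, g, hg, hgy⟩
  have hg0 : g ≠ 0 := fun h => hgy (by rw [h, map_zero])
  obtain ⟨x, hx⟩ : ∃ x, MvPolynomial.eval x (f * g) ≠ 0 := by
    by_contra! h
    exact mul_ne_zero hf hg0 (MvPolynomial.funext fun x => by rw [h x, map_zero])
  rw [map_mul] at hx
  exact ⟨x, left_ne_zero_of_mul hx, g, hg, right_ne_zero_of_mul hx⟩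

theorem exists_linearCombos_eq {R : Type*} [CommRing R] {s t : ℕ} (a : Fin s → R) (x : Fin t → R)
    (hx : ∀ i, x i ∈ Ideal.span (Set.range a)) : ∃ c, linearCombos a c = x := by
  choose c hc using fun i => Ideal.mem_span_range_iff_exists_fun.1 (hx i)
  exact ⟨fun p => c p.1 p.2, funext hc⟩

theorem linearCombos_mem {R : Type*} [CommRing R] {s t : ℕ} (a : Fin s → R)
    (c : Fin t × Fin s → R) (i : Fin t) : linearCombos a c i ∈ Ideal.span (Set.range a) :=
  Submodule.sum_mem _ fun j _ => Ideal.mul_mem_left _ _ (Ideal.subset_span ⟨j, rfl⟩)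

/-- By the modular law `I ^ 2 ∩ (I ^ 3 + H) = I ^ 3 + (H ∩ I ^ 2)`, and the second summand is `H I`.
-/
theorem QuotLengthLEOne.of_inf_eq {R : Type*} [CommRing R] [IsLocalRing R] {I H : Ideal R}
    (hH : H ⊓ I ^ 2 = H * I) (h : QuotLengthLEOne (I ^ 2) (I ^ 3 + H)) :
    QuotLengthLEOne (I ^ 2) (H * I + I ^ 3) := by
  obtain ⟨w, hw, h1, h2⟩ := h
  have hpow : I ^ 3 ≤ I ^ 2 := Ideal.pow_le_pow_right (by norm_num)
  have key : ∀ y ∈ I ^ 2, y ∈ I ^ 3 + H → y ∈ H * I + I ^ 3 := by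
    intro y hy hy'
    obtain ⟨z, hz, g, hg, rfl⟩ := Submodule.mem_sup.1 hy'
    have hg' : g ∈ H * I := by
      rw [← hH]
      exact Submodule.mem_inf.2 ⟨hg, by simpa using sub_mem hy (hpow hz)⟩
    exact add_mem (Submodule.mem_sup_right hz) (Submodule.mem_sup_left hg')
  refine ⟨w, hw, fun y hy => ?_, fun y hy => key y (Ideal.mul_le_right hy) (h2 hy)⟩
  obtain ⟨z, hz, g, hg, rfl⟩ := Submodule.mem_sup.1 (h1 hy)
  obtain ⟨r, rfl⟩ := Ideal.mem_span_singleton'.1 hg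
  refine add_mem (Submodule.mem_sup_left (key z ?_ hz)) (Submodule.mem_sup_right hg)
  simpa using sub_mem hy (Ideal.mul_mem_left _ r hw)

theorem IsStretched.isJStretched {R : Type*} [CommRing R] [IsLocalRing R] [IsNoetherianRing R]
    [Infinite (ResidueField R)] {n : ℕ} (hd : ringKrullDim R = (n + 1 : ℕ)) {I : Ideal R}
    (hI : I.radical = maximalIdeal R) (h : IsStretched I) : IsJStretched I := by
  obtain ⟨H, hmin, hcap, hlen⟩ := h
  obtain ⟨x, rfl⟩ := hmin.exists_span_range_eq hI hd
  rw [hilbertFun_two_le_one_iff] at hlen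
  have hlen' := hlen.of_inf_eq hcap
  refine ⟨n, hd, fun s a ha => ?_⟩
  obtain ⟨c₀, rfl⟩ := exists_linearCombos_eq a x fun i => by
    rw [ha]
    exact hmin.prop.1 (Ideal.subset_span ⟨i, rfl⟩)
  obtain ⟨f, hf, hf'⟩ := quotLengthLEOne_of_general a a (I ^ 3) c₀ (by rwa [ha, ← sq])
  refine ⟨_, isZariskiDenseOpen_ne_zero hf, fun c hc => ?_⟩
  have hc' := hf' c hc
  rw [ha, ← sq] at hc'
  change jStretchedLength I (idealSaturation (Ideal.span (Set.range fun i : Fin n =>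
    linearCombos a c i.castSucc)) I) (linearCombos a c (Fin.last n)) ≤ 1
  rw [jStretchedLength_le_one_iff]
  refine hc'.mono ?_
  -- The first `n` elements lie in the saturation, so the module in the `j`-stretched condition is a
  -- quotient of the one just bounded.
  have hle : Ideal.span (Set.range (linearCombos a c)) ≤
      Ideal.span {linearCombos a c (Fin.last n)} ⊔ idealSaturation
        (Ideal.span (Set.range fun i : Fin n => linearCombos a c i.castSucc)) I := by
    rw [Ideal.span_le]
    rintro _ ⟨i, rfl⟩
    refine Fin.lastCases (Submodule.mem_sup_left (Ideal.mem_span_singleton_self _))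
      (fun j => Submodule.mem_sup_right ⟨1, one_pos, fun y _ => ?_⟩) i
    exact Ideal.mul_mem_right _ _ (Ideal.subset_span ⟨j, rfl⟩)
  rw [Submodule.add_eq_sup, Submodule.add_eq_sup, Submodule.add_eq_sup]
  refine sup_le ((Ideal.mul_mono_left hle).trans ?_) (le_sup_of_le_left le_sup_right)
  rw [Ideal.sup_mul]
  exact sup_le (le_sup_of_le_left le_sup_left) (Ideal.mul_le_left.trans le_sup_right)

/-- If each relation `∑ r i * x i ∈ I ^ 2` has coefficients in `I`, then `J ∩ I ^ 2 = J I` for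
`J = (x)`. -/
theorem span_inf_sq_eq {R : Type*} [CommRing R] {I : Ideal R} {t : ℕ} (x : Fin t → R)
    (hx : ∀ i, x i ∈ I) (h : ∀ r : Fin t → R, ∑ i, r i * x i ∈ I ^ 2 → ∀ i, r i ∈ I) :
    Ideal.span (Set.range x) ⊓ I ^ 2 = Ideal.span (Set.range x) * I := by
  apply le_antisymm
  · rintro y ⟨hy, hy'⟩
    obtain ⟨r, rfl⟩ := Ideal.mem_span_range_iff_exists_fun.1 hy
    refine Submodule.sum_mem _ fun i _ => ?_
    rw [mul_comm (r i)]
    exact Ideal.mul_mem_mul (Ideal.subset_span ⟨i, rfl⟩) (h r hy' i)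
  · refine le_inf Ideal.mul_le_left ?_
    rw [sq]
    refine Ideal.mul_mono_left (Ideal.span_le.2 ?_)
    rintro _ ⟨i, rfl⟩
    exact hx i

/-- If `J = (x)` with `x` a regular sequence in `I` and `J ∩ I ^ 2 = J I`, then each relation
`∑ r i * x i ∈ I ^ 2` has coefficients in `I`. -/
theorem coefficients_mem_of_inf_sq_eq {R : Type*} [CommRing R] {I : Ideal R} {t : ℕ}
    (x : Fin t → R) (hxI : Ideal.span (Set.range x) ≤ I)
    (hx : ∀ i y, y * x i ∈ Ideal.span (x '' Set.Iio i) → y ∈ Ideal.span (x '' Set.Iio i))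
    (h : I ^ 2 ⊓ Ideal.span (Set.range x) = Ideal.span (Set.range x) * I) (r : Fin t → R)
    (hr : ∑ i, r i * x i ∈ I ^ 2) (i : Fin t) : r i ∈ I := by
  have h1 : ∑ i, r i * x i ∈ I • Submodule.span R (Set.range x) := by
    rw [smul_eq_mul, mul_comm, Ideal.submodule_span_eq, ← h]
    exact ⟨hr, Submodule.sum_mem _ fun i _ => Ideal.mul_mem_left _ _ (Ideal.subset_span ⟨i, rfl⟩)⟩
  obtain ⟨b, hb, hbr⟩ := (Submodule.mem_ideal_smul_span_iff_exists_sum I x _).1 h1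
  rw [Finsupp.sum_fintype _ _ (by simp)] at hbr
  have h2 := mem_span_of_sum_mul_eq_zero x hx (fun i => r i - b i) (by
    simp only [sub_mul, Finset.sum_sub_distrib]
    rw [← hbr]
    simp) i
  simpa using add_mem (hxI h2) (hb i)

theorem IsJStretched.isStretched {R : Type*} [CommRing R] [IsLocalRing R] [IsNoetherianRing R]
    [Infinite (ResidueField R)] (hR : IsCohenMacaulayLocal R) {I : Ideal R}
    (hI : I.radical = maximalIdeal R) {H : Ideal R} (hH : IsMinimalReduction H I)
    (hHI : I ^ 2 ⊓ H = H * I) (h : IsJStretched I) : IsStretched I := by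
  obtain ⟨n, hd, hgen⟩ := h
  obtain ⟨x, rfl⟩ := hH.exists_span_range_eq hI hd
  obtain ⟨a, ha⟩ := exists_span_range_spanFinrank_eq I
  obtain ⟨U, ⟨-, hU⟩, hU'⟩ := hgen _ a ha
  obtain ⟨c₀, rfl⟩ := exists_linearCombos_eq a x fun i => by
    rw [ha]
    exact hH.prop.1 (Ideal.subset_span ⟨i, rfl⟩)
  obtain ⟨r, hr⟩ := hH.prop.2
  obtain ⟨b, hb⟩ := exists_span_range_spanFinrank_eq (I ^ r)
  -- For this fixed exponent `r`, being a reduction is the containment `I * I ^ r ⊆ (x) * I ^ r`,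
  -- which holds at `c₀` because `H` is a reduction.
  obtain ⟨f, hf, hf'⟩ := mul_le_of_general a b ⊥ c₀ (by
    rw [ha, hb, Submodule.add_eq_sup, sup_bot_eq, ← hr, pow_succ'])
  obtain ⟨g, hg, hg'⟩ := coefficients_mem_of_general hI a ha c₀
    (coefficients_mem_of_inf_sq_eq _ hH.prop.1
      (hR.mem_span_of_mul_mem hd _ (by rw [hH.prop.radical_eq, hI])) hHI)
  have hopen := isZariskiDenseOpen_ne_zero (mul_ne_zero hf hg)
  -- The dense set `U` meets the nonempty open set where `f * g` does not vanish, so a single point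
  -- has all the required properties.
  obtain ⟨u, hu, hufg⟩ := hU _ hopen.1
    ((hopen.2 Set.univ ⟨{1}, by simp⟩ Set.univ_nonempty).mono Set.inter_subset_left)
  choose c hc using fun p => residue_surjective (R := R) (u p)
  obtain rfl : (fun p => residue R (c p)) = u := funext hc
  rw [Set.mem_ofPred_eq, map_mul] at hufg
  have hred := hf' c (left_ne_zero_of_mul hufg)
  have hcoeff := hg' c (right_ne_zero_of_mul hufg)
  have hlen := hU' c hu
  set x := linearCombos a c with hx
  change jStretchedLength I (idealSaturation (Ideal.span (Set.range fun i : Fin n =>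
    x i.castSucc)) I) (x (Fin.last n)) ≤ 1 at hlen
  have hxI : ∀ i, x i ∈ I := fun i => ha ▸ linearCombos_mem a c i
  have hJI : Ideal.span (Set.range x) ≤ I := Ideal.span_le.2 (by rintro _ ⟨i, rfl⟩; exact hxI i)
  have hJred : IsReduction (Ideal.span (Set.range x)) I := by
    refine ⟨hJI, r, le_antisymm ?_ ?_⟩
    · rw [ha, hb, Submodule.add_eq_sup, sup_bot_eq, ← pow_succ'] at hred
      exact hred
    · rw [pow_succ']
      exact Ideal.mul_mono_left hJI
  refine ⟨_, isMinimalReduction_of_card_le hI x hd.ge hJred, span_inf_sq_eq x hxI hcoeff, ?_⟩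
  rw [hilbertFun_two_le_one_iff]
  rw [jStretchedLength_le_one_iff] at hlen
  refine hlen.mono ?_
  have hlast : Ideal.span {x (Fin.last n)} ≤ Ideal.span (Set.range x) :=
    Ideal.span_mono (by rintro _ rfl; exact ⟨_, rfl⟩)
  -- The last parameter is regular modulo the others. If one of its powers multiplies `y` into the
  -- ideal they generate, then `y` is already there, so the saturation adds nothing.
  have hsat : idealSaturation (Ideal.span (Set.range fun i : Fin n => x i.castSucc)) I ≤
      Ideal.span (Set.range x) := by
    rintro y ⟨δ, -, hy⟩
    have h1 := hy _ (Ideal.pow_mem_pow (hxI (Fin.last n)) δ)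
    clear hy
    rw [← image_Iio_last] at h1
    refine Ideal.span_mono (Set.image_subset_range x (Set.Iio (Fin.last n))) ?_
    induction δ with
    | zero => simpa using h1
    | succ δ ih =>
      refine ih (hR.mem_span_of_mul_mem hd x (by rw [hJred.radical_eq, hI]) _ _ ?_)
      rwa [mul_assoc, ← pow_succ]
  rw [Submodule.add_eq_sup, Submodule.add_eq_sup, Submodule.add_eq_sup]
  exact sup_le (sup_le (Ideal.mul_le_left.trans (hlast.trans le_sup_right)) le_sup_left)
    (hsat.trans le_sup_right)

theorem mainTheorem10 {R : Type*} [CommRing R] [IsLocalRing R] [IsNoetherianRing R]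
    [Infinite (IsLocalRing.ResidueField R)]
    (hCM : IsCohenMacaulayLocal R) (hchar : IsEquicharacteristic R)
    (hdim : 1 ≤ ringKrullDim R)
    (I : Ideal R) (hI : I.radical = IsLocalRing.maximalIdeal R)
    (H : Ideal R) (hH : IsMinimalReduction H I) (hHI : I ^ 2 ⊓ H = H * I) :
    IsStretched I ↔ IsJStretched I := by
  obtain ⟨rs, -, -, hlen⟩ := id hCM
  rw [hlen] at hdim
  have hpos : 1 ≤ rs.length := by exact_mod_cast hdim
  rw [← Nat.sub_add_cancel hpos] at hlen
  exact ⟨fun h => h.isJStretched hlen hI, fun h => h.isStretched hCM hI hH hHI⟩
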